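/- An instance $(G,L,w)$ of the Weighted List Coloring Problem (WLCP) consists of a finite simple graph $G=(V,E)$, a finite set $\mathcal C$ of colors, a list $L(v)\subseteq\mathcal C$ for every $v\in V$, and weights $w\in\mathbb Z_{\ge 0}^{\mathcal C}$. A list coloring of $(G,L)$ is a function $f:V\to\mathcal C$ with $f(v)\in L(v)$ for all $v\in V$ and $f(u)\ne f(v)$ for every edge $uv\in E$; its weight is $w(f)=\sum_{j\in f(V)}w_j$, the sum of the weights of the colors that are used. The task is to output a list coloring of minimum weight, or to answer that no list coloring exists. For $j\in\mathcal C$ let $V_j=\{v\in V: j\in L(v)\}$, and let the color graph $G_j=G[V_j]$ be the subgraph of $G$ induced by $V_j$. Proposition. The WLCP is polynomial-time solvable on instances $(G,L,w)$ such that $G_j$ is a complete graph for all $j\in\mathcal C$. That is, there are a random access machine program (with addition, subtraction and indirect addressing) and a polynomial $p$ such that, on every such instance, given by $|V|$, $|\mathcal C|$, the adjacency matrix of $G$, the vertex-color incidence matrix of the lists and the weights, the program halts with a correct answer, at total logarithmic cost at most $p(N)$, where $N$ is the total binary length of the input. -/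

import Mathlib

/-! ### Random access machines with logarithmic cost

Registers `R 0, R 1, R 2, …` hold natural numbers; there is a read-only input tape of natural
numbers, read from left to right, and a write-only output tape. The instruction set is the classical
one (constants, addition, subtraction, indirect load and store, read, print); control flow
is structured (sequencing, conditional, while loop on `R i > 0`). -/

namespace RAM

/-- The state: register contents, the unread part of the input, and the output printed so far. -/
structure State where
  reg : ℕ → ℕ
  inp : List ℕ
  out : List ℕ

/-- Elementary instructions; the arguments `i j k c` are literals in the program text. -/
inductive Instr where
  /-- `R i := c` -/
  | const (i c : ℕ)
  /-- `R i := R j + R k` -/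
  | add (i j k : ℕ)
  /-- `R i := R j - R k` (which is `0` if `R j < R k`) -/
  | sub (i j k : ℕ)
  /-- `R i := R (R j)` -/
  | load (i j : ℕ)
  /-- `R (R i) := R j` -/
  | store (i j : ℕ)
  /-- Read the next input number into `R i` (`0` if the input is exhausted). -/
  | read (i : ℕ)
  /-- Append `R j` to the output. -/
  | print (j : ℕ)

/-- Programs. -/
inductive Prog where
  | skip
  | instr (a : Instr)
  | seq (p q : Prog)
  /-- If `R i > 0` then `p` else `q`. -/
  | ifPos (i : ℕ) (p q : Prog)
  /-- While `R i > 0` do `p`. -/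
  | whilePos (i : ℕ) (p : Prog)

/-- The logarithmic cost of a number: its binary length plus one. -/
def len (x : ℕ) : ℕ := Nat.size x + 1

/-- The effect of an elementary instruction. -/
def Instr.effect (s : State) : Instr → State
  | .const i c => { s with reg := Function.update s.reg i c }
  | .add i j k => { s with reg := Function.update s.reg i (s.reg j + s.reg k) }
  | .sub i j k => { s with reg := Function.update s.reg i (s.reg j - s.reg k) }
  | .load i j => { s with reg := Function.update s.reg i (s.reg (s.reg j)) }
  | .store i j => { s with reg := Function.update s.reg (s.reg i) (s.reg j) }
  | .read i => { s with reg := Function.update s.reg i (s.inp.headD 0), inp := s.inp.tail }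
  | .print j => { s with out := s.out ++ [s.reg j] }

/-- The logarithmic cost of an elementary instruction: the total length of the numbers
handled, including the addresses that are computed at run time. -/
def Instr.cost (s : State) : Instr → ℕ
  | .const _ c => len c
  | .add _ j k => len (s.reg j) + len (s.reg k)
  | .sub _ j k => len (s.reg j) + len (s.reg k)
  | .load _ j => len (s.reg j) + len (s.reg (s.reg j))
  | .store i j => len (s.reg i) + len (s.reg j)
  | .read _ => len (s.inp.headD 0)
  | .print j => len (s.reg j)

/-- `Exec p s t s'`: started in state `s`, the program `p` halts in state `s'` after a
computation of total logarithmic cost `t`. The rules are deterministic; a computation that does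
not halt has no derivation. -/
inductive Exec : Prog → State → ℕ → State → Prop where
  | skip (s : State) : Exec .skip s 1 s
  | instr (a : Instr) (s : State) : Exec (.instr a) s (a.cost s) (a.effect s)
  | seq {p q : Prog} {s s₁ s₂ : State} {t₁ t₂ : ℕ} :
      Exec p s t₁ s₁ → Exec q s₁ t₂ s₂ → Exec (.seq p q) s (t₁ + t₂) s₂
  | ifTrue {i : ℕ} {p q : Prog} {s s₁ : State} {t : ℕ} :
      0 < s.reg i → Exec p s t s₁ → Exec (.ifPos i p q) s (len (s.reg i) + t) s₁
  | ifFalse {i : ℕ} {p q : Prog} {s s₁ : State} {t : ℕ} :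
      s.reg i = 0 → Exec q s t s₁ → Exec (.ifPos i p q) s (len (s.reg i) + t) s₁
  | whileTrue {i : ℕ} {p : Prog} {s s₁ s₂ : State} {t₁ t₂ : ℕ} :
      0 < s.reg i → Exec p s t₁ s₁ → Exec (.whilePos i p) s₁ t₂ s₂ →
      Exec (.whilePos i p) s (len (s.reg i) + t₁ + t₂) s₂
  | whileFalse {i : ℕ} {p : Prog} {s : State} :
      s.reg i = 0 → Exec (.whilePos i p) s (len (s.reg i)) s

/-- The initial state on input `x`: all registers are `0` and nothing has been printed. -/
def init (x : List ℕ) : State := ⟨fun _ => 0, x, []⟩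

/-- The size of an input: its total binary length. -/
def inputSize (x : List ℕ) : ℕ := (x.map len).sum

/-- A search problem, with instances in `α` encoded by `encode` and with correct answers
described by `IsAnswer`, is *polynomial-time solvable on the instances in `S`*: a single program
halts on every instance in `S` with a correct answer, at a cost that is bounded by a
fixed polynomial in the size of the encoded instance. -/
def PolyTimeSolvableOn {α : Type*} (encode : α → List ℕ) (IsAnswer : α → List ℕ → Prop)
    (S : Set α) : Prop :=
  ∃ (P : Prog) (b : Polynomial ℕ), ∀ a ∈ S, ∃ (t : ℕ) (s : State),
    Exec P (init (encode a)) t s ∧ t ≤ b.eval (inputSize (encode a)) ∧ IsAnswer a s.out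

end RAM

/-! ### The weighted list coloring problem -/

/-- An instance `(G, L, w)` of the weighted list coloring problem: the vertices are numbered
`0, …, n - 1` and the colors are numbered `0, …, m - 1`. -/
structure WLCP where
  /-- the number of vertices -/
  n : ℕ
  /-- the number of colors -/
  m : ℕ
  /-- the graph -/
  G : SimpleGraph (Fin n)
  /-- the lists of colors -/
  L : Fin n → Finset (Fin m)
  /-- the weights of the colors -/
  w : Fin m → ℕ

namespace WLCP

/-- `f` is a list coloring of `(G, L)`. -/
def IsListColoring (I : WLCP) (f : Fin I.n → Fin I.m) : Prop :=
  (∀ u v, I.G.Adj u v → f u ≠ f v) ∧ ∀ v, f v ∈ I.L v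

/-- The active colors of `f`: those assigned to some vertex. -/
def activeColors (I : WLCP) (f : Fin I.n → Fin I.m) : Finset (Fin I.m) :=
  Finset.univ.image f

/-- The weight of a coloring: the sum of the weights of its active colors. -/
def weight (I : WLCP) (f : Fin I.n → Fin I.m) : ℕ :=
  ∑ j ∈ I.activeColors f, I.w j

/-- `f` is a list coloring of minimum weight. -/
def IsOptimal (I : WLCP) (f : Fin I.n → Fin I.m) : Prop :=
  I.IsListColoring f ∧ ∀ g, I.IsListColoring g → I.weight f ≤ I.weight g

/-- The vertices whose lists contain the color `j`. -/
def colorVertexSet (I : WLCP) (j : Fin I.m) : Set (Fin I.n) := {v | j ∈ I.L v}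

/-- The color graph of `j`: the subgraph of `G` induced by the vertices whose lists contain `j`. -/
def colorGraph (I : WLCP) (j : Fin I.m) : SimpleGraph (I.colorVertexSet j) :=
  I.G.induce (I.colorVertexSet j)

open Classical in
/-- The input that describes an instance: `n`, `m`, the adjacency matrix of the graph, the
vertex-color incidence matrix of the lists (both row by row), and the weights. -/
noncomputable def encode (I : WLCP) : List ℕ :=
  [I.n, I.m]
    ++ (List.finRange I.n).flatMap
        (fun u => (List.finRange I.n).map (fun v => if I.G.Adj u v then 1 else 0))
    ++ (List.finRange I.n).flatMap
        (fun v => (List.finRange I.m).map (fun j => if j ∈ I.L v then 1 else 0))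
    ++ (List.finRange I.m).map I.w

/-- The correct answers: `0` if there is no list coloring, and otherwise `1` followed
by the colors `f 0, …, f (n - 1)` of some list coloring `f` of minimum weight. -/
def IsAnswer (I : WLCP) (y : List ℕ) : Prop :=
  ((¬ ∃ f, I.IsListColoring f) ∧ y = [0]) ∨
    ∃ f, I.IsOptimal f ∧ y = 1 :: List.ofFn (fun v => (f v : ℕ))

end WLCP

/-! If all color graphs are complete, two vertices with a common listed color are adjacent, so every
list coloring is injective; conversely, an injective choice from the lists is proper whatever the
edges are. The task is therefore to match all `n` vertices with distinct listed colors at minimum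
total weight.

The sets of colors that can be matched into the vertices are the independent sets of a transversal
matroid, so the greedy algorithm is optimal: consider colors by increasing weight and keep a color
whenever the kept set stays matchable. `Matchable.card_le_of_maximal` derives from Hall's theorem
and submodularity of the neighborhood size that maximal matchable sets have maximum size. Applied
below every weight threshold, this gives `IsGreedy.sum_le`. A coloring exists exactly when the
greedy set has `n` elements.

Whether a color can be added is decided by an auction. An unplaced color takes its cheapest vertex,
raises the price by one and evicts the owner. A dummy vertex `n` of price `n + 1`, open to all
colors, absorbs failure. Prices stay at most `n + 2`, so there are polynomially many bids
(`IsAuction.hand_eq_none`). If the dummy stays free, the result is a matching; if it is taken, a gap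
among the prices exhibits a violation of Hall's condition (`IsAuction.not_matchable`).

The algorithm is written in a small language of bounded loops without addition of variables. Each
operation raises the largest value by at most a constant, so over polynomially many steps the
numbers keep polynomial binary length although the weights may be exponential. `Stmt.exec_code`
turns this into a bound on the logarithmic cost of the compiled program. -/

/-! ### A language of bounded loops, compiled to random access machines

The only arithmetic operations are successor and truncated subtraction, so that the values
grow polynomially whatever the program does; the loops are bounded by variables `0, 1, 2`, which
the loop bodies may not overwrite. -/

namespace RAM

/-- The state of a loop program: scalar variables, five arrays, input and output. -/
structure Env where
  v : ℕ → ℕ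
  a : Fin 5 → ℕ → ℕ
  inp : List ℕ
  out : List ℕ

/-- Elementary operations of loop programs. -/
inductive Op where
  | const (x c : ℕ)
  | inc (x y : ℕ)
  | copy (x y : ℕ)
  | sub (x y z : ℕ)
  | get (x : ℕ) (k : Fin 5) (y : ℕ)
  | set (k : Fin 5) (y x : ℕ)
  | read (x : ℕ)
  | print (x : ℕ)

/-- Loop programs. In `loop i b p` the body `p` is run for `i = 0, …, b - 1`. -/
inductive Stmt where
  | skip
  | op (o : Op)
  | seq (p q : Stmt)
  | ifPos (x : ℕ) (p q : Stmt)
  | loop (i b : ℕ) (p : Stmt)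

/-- Assign a variable. -/
def Env.setv (e : Env) (x n : ℕ) : Env := { e with v := Function.update e.v x n }

/-- Assign an array element. -/
def Env.seta (e : Env) (k : Fin 5) (i n : ℕ) : Env :=
  { e with a := Function.update e.a k (Function.update (e.a k) i n) }

/-- Move on to the next input. -/
def Env.next (e : Env) : Env := { e with inp := e.inp.tail }

@[simp] theorem Env.next_v (e : Env) : e.next.v = e.v := rfl

@[simp] theorem Env.next_a (e : Env) : e.next.a = e.a := rfl

@[simp] theorem Env.next_inp (e : Env) : e.next.inp = e.inp.tail := rfl

@[simp] theorem Env.next_out (e : Env) : e.next.out = e.out := rfl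

@[simp] theorem Env.setv_v (e : Env) (x n y : ℕ) :
    (e.setv x n).v y = if y = x then n else e.v y := Function.update_apply ..

@[simp] theorem Env.setv_a (e : Env) (x n : ℕ) : (e.setv x n).a = e.a := rfl

@[simp] theorem Env.setv_inp (e : Env) (x n : ℕ) : (e.setv x n).inp = e.inp := rfl

@[simp] theorem Env.setv_out (e : Env) (x n : ℕ) : (e.setv x n).out = e.out := rfl

@[simp] theorem Env.seta_v (e : Env) (k : Fin 5) (i n : ℕ) : (e.seta k i n).v = e.v := rfl

@[simp] theorem Env.seta_a (e : Env) (k l : Fin 5) (i n j : ℕ) :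
    (e.seta k i n).a l j = if l = k ∧ j = i then n else e.a l j := by
  by_cases h : l = k
  · subst h
    simp [Env.seta, Function.update_apply]
  · simp [Env.seta, h]

@[simp] theorem Env.seta_inp (e : Env) (k : Fin 5) (i n : ℕ) : (e.seta k i n).inp = e.inp := rfl

@[simp] theorem Env.seta_out (e : Env) (k : Fin 5) (i n : ℕ) : (e.seta k i n).out = e.out := rfl

/-- The effect of an elementary operation. -/
def Op.run (e : Env) : Op → Env
  | .const x c => e.setv x c
  | .inc x y => e.setv x (e.v y + 1)
  | .copy x y => e.setv x (e.v y)
  | .sub x y z => e.setv x (e.v y - e.v z)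
  | .get x k y => e.setv x (e.a k (e.v y))
  | .set k y x => e.seta k (e.v y) (e.v x)
  | .read x => e.next.setv x (e.inp.headD 0)
  | .print x => { e with out := e.out ++ [e.v x] }

/-- Apply `f 0, …, f (k - 1)` in this order. -/
def iter {α : Type*} (f : ℕ → α → α) : ℕ → α → α
  | 0, e => e
  | k + 1, e => f k (iter f k e)

/-- The effect of a loop program. -/
def Stmt.run : Stmt → Env → Env
  | .skip, e => e
  | .op o, e => o.run e
  | .seq p q, e => q.run (p.run e)
  | .ifPos x p q, e => if 0 < e.v x then p.run e else q.run e
  | .loop i b p, e => iter (fun k e' => p.run (e'.setv i k)) (e.v b) e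

/-- The variables that a program may assign. -/
def Stmt.vars : Stmt → List ℕ
  | .skip => []
  | .op (.const x _) => [x]
  | .op (.inc x _) => [x]
  | .op (.copy x _) => [x]
  | .op (.sub x _ _) => [x]
  | .op (.get x _ _) => [x]
  | .op (.set _ _ _) => []
  | .op (.read x) => [x]
  | .op (.print _) => []
  | .seq p q => p.vars ++ q.vars
  | .ifPos _ p q => p.vars ++ q.vars
  | .loop i _ p => i :: p.vars

/-- The arrays that a program may assign. -/
def Stmt.arrs : Stmt → List (Fin 5)
  | .skip => []
  | .op (.set k _ _) => [k]
  | .op _ => []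
  | .seq p q => p.arrs ++ q.arrs
  | .ifPos _ p q => p.arrs ++ q.arrs
  | .loop _ _ p => p.arrs

/-- The program never prints. -/
def Stmt.noPrint : Stmt → Bool
  | .skip => true
  | .op (.print _) => false
  | .op _ => true
  | .seq p q => p.noPrint && q.noPrint
  | .ifPos _ p q => p.noPrint && q.noPrint
  | .loop _ _ p => p.noPrint

/-- All loops are bounded by one of the variables `0, 1, 2`. -/
def Stmt.loopsOk : Stmt → Bool
  | .skip => true
  | .op _ => true
  | .seq p q => p.loopsOk && q.loopsOk
  | .ifPos _ p q => p.loopsOk && q.loopsOk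
  | .loop _ b p => decide (b < 3) && p.loopsOk

/-! ### Loop invariants and syntactic frame rules -/

theorem iter_induct {α : Type*} (f : ℕ → α → α) (I : ℕ → α → Prop) {e : α} {n : ℕ} (h0 : I 0 e)
    (hs : ∀ k e', k < n → I k e' → I (k + 1) (f k e')) : I n (iter f n e) := by
  induction n with
  | zero => exact h0
  | succ n ih => exact hs n _ (Nat.lt_succ_self n) (ih fun k e' hk => hs k e' (by omega))

theorem Stmt.run_loop (I : ℕ → Env → Prop) {e : Env} {i b : ℕ} {p : Stmt} (h0 : I 0 e)
    (hs : ∀ k e', k < e.v b → I k e' → I (k + 1) (p.run (e'.setv i k))) :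
    I (e.v b) ((Stmt.loop i b p).run e) :=
  iter_induct _ I h0 hs

/-- Frame rule: the premise is a decidable condition on the program text, so for concrete programs
`decide` settles which variables survive. `Stmt.run_a` and `Stmt.run_out` serve the same purpose for
arrays and output. -/
theorem Stmt.run_v {p : Stmt} {x : ℕ} (hx : x ∉ p.vars) (e : Env) : (p.run e).v x = e.v x := by
  induction p generalizing e with
  | skip => rfl
  | op o =>
    cases o <;> simp_all [Stmt.vars, Stmt.run, Op.run]
  | seq p q hp hq =>
    simp only [Stmt.vars, List.mem_append, not_or] at hx
    rw [Stmt.run, hq hx.2, hp hx.1]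
  | ifPos y p q hp hq =>
    simp only [Stmt.vars, List.mem_append, not_or] at hx
    rw [Stmt.run]
    split_ifs
    · exact hp hx.1 e
    · exact hq hx.2 e
  | loop i b p hp =>
    simp only [Stmt.vars, List.mem_cons, not_or] at hx
    refine Stmt.run_loop (fun _ e' => e'.v x = e.v x) rfl fun k e' _ he => ?_
    rw [hp hx.2, Env.setv_v, if_neg hx.1, he]

theorem Stmt.run_a {p : Stmt} {x : Fin 5} (hx : x ∉ p.arrs) (e : Env) :
    (p.run e).a x = e.a x := by
  induction p generalizing e with
  | skip => rfl
  | op o =>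
    cases o <;> simp_all [Stmt.arrs, Stmt.run, Op.run, Env.setv, Env.seta]
  | seq p q hp hq =>
    simp only [Stmt.arrs, List.mem_append, not_or] at hx
    rw [Stmt.run, hq hx.2, hp hx.1]
  | ifPos y p q hp hq =>
    simp only [Stmt.arrs, List.mem_append, not_or] at hx
    rw [Stmt.run]
    split_ifs
    · exact hp hx.1 e
    · exact hq hx.2 e
  | loop i b p hp =>
    refine Stmt.run_loop (fun _ e' => e'.a x = e.a x) rfl fun k e' _ he => ?_
    rw [hp hx, ← he]; rfl

theorem Stmt.run_out {p : Stmt} (hx : p.noPrint = true) (e : Env) : (p.run e).out = e.out := by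
  induction p generalizing e with
  | skip => rfl
  | op o =>
    cases o <;> simp_all [Stmt.noPrint, Stmt.run, Op.run, Env.setv, Env.seta]
  | seq p q hp hq =>
    simp only [Stmt.noPrint, Bool.and_eq_true] at hx
    rw [Stmt.run, hq hx.2, hp hx.1]
  | ifPos y p q hp hq =>
    simp only [Stmt.noPrint, Bool.and_eq_true] at hx
    rw [Stmt.run]
    split_ifs
    · exact hp hx.1 e
    · exact hq hx.2 e
  | loop i b p hp =>
    refine Stmt.run_loop (fun _ e' => e'.out = e.out) rfl fun k e' _ he => ?_
    rw [hp hx, ← he]; rfl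

/-! #### Growth of the values -/

/-- All values in `e` are at most `M`. -/
structure Env.Bounded (M : ℕ) (e : Env) : Prop where
  v : ∀ x, e.v x ≤ M
  a : ∀ k i, e.a k i ≤ M
  inp : ∀ x ∈ e.inp, x ≤ M

theorem Env.Bounded.mono {M M' : ℕ} {e : Env} (h : e.Bounded M) (hM : M ≤ M') : e.Bounded M' :=
  ⟨fun x => (h.v x).trans hM, fun k i => (h.a k i).trans hM, fun x hx => (h.inp x hx).trans hM⟩

theorem Env.Bounded.setv {M : ℕ} {e : Env} (h : e.Bounded M) {n : ℕ} (x : ℕ) (hn : n ≤ M) :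
    (e.setv x n).Bounded M := by
  refine ⟨fun y => ?_, h.a, h.inp⟩
  rw [Env.setv_v]
  split_ifs
  exacts [hn, h.v y]

theorem Env.Bounded.headD {M : ℕ} {e : Env} (h : e.Bounded M) : e.inp.headD 0 ≤ M := by
  have := h.inp
  cases hl : e.inp with
  | nil => simp
  | cons y l => simp_all

/-- A bound on the increase of the values by an elementary operation. -/
def Op.growth : Op → ℕ
  | .const _ c => c
  | .inc _ _ => 1
  | _ => 0

theorem Op.bounded_run (o : Op) {M : ℕ} {e : Env} (h : e.Bounded M) :
    (o.run e).Bounded (M + o.growth) := by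
  cases o with
  | const x c => exact (h.mono (Nat.le_add_right _ _)).setv _ (by simp [Op.growth])
  | inc x y => exact (h.mono (Nat.le_add_right _ _)).setv _ (by simp [Op.growth, h.v])
  | copy x y => exact h.setv _ (h.v _)
  | sub x y z => exact h.setv _ ((Nat.sub_le _ _).trans (h.v _))
  | get x k y => exact h.setv _ (h.a _ _)
  | set k y x =>
    refine ⟨h.v, fun k' i => ?_, h.inp⟩
    rw [Op.run, Env.seta_a]
    split_ifs
    exacts [h.v x, h.a k' i]
  | read x =>
    have h' : e.next.Bounded M := ⟨h.v, h.a, fun y hy => h.inp y (List.mem_of_mem_tail hy)⟩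
    exact h'.setv x h.headD
  | print x => exact ⟨h.v, h.a, h.inp⟩

/-- A bound on the increase of the values, if the loop bounds are at most `X`. -/
noncomputable def Stmt.growth : Stmt → Polynomial ℕ
  | .skip => 0
  | .op o => (o.growth : Polynomial ℕ)
  | .seq p q => p.growth + q.growth
  | .ifPos _ p q => p.growth + q.growth
  | .loop _ _ p => Polynomial.X * p.growth

/-- The variables `0, 1, 2` are not assigned. -/
def Stmt.protectsBounds (p : Stmt) : Prop := ∀ x ∈ p.vars, 3 ≤ x

theorem Stmt.protectsBounds.run_v {p : Stmt} (h : p.protectsBounds) (e : Env) {b : ℕ}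
    (hb : b < 3) : (p.run e).v b = e.v b :=
  Stmt.run_v (fun hx => absurd (h b hx) (by omega)) e

/-- Growth is additive: each round adds at most `g`, independently of the current size. The
hypothesis `n ≤ M + 1` makes the indices `0, …, n - 1` written to the loop variable at most `M`. -/
theorem iter_bounds {p : Stmt} (hp : p.protectsBounds) {q M g i n : ℕ} (hi : 3 ≤ i) {e : Env}
    (hrun : ∀ M e', (∀ b < 3, e'.v b ≤ q) → e'.Bounded M → (p.run e').Bounded (M + g))
    (hq : ∀ b < 3, e.v b ≤ q) (h : e.Bounded M) (hn : n ≤ M + 1) :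
    (∀ b < 3, (iter (fun k e' => p.run (e'.setv i k)) n e).v b ≤ q) ∧
      (iter (fun k e' => p.run (e'.setv i k)) n e).Bounded (M + n * g) := by
  induction n with
  | zero => exact ⟨hq, by simpa [iter] using h⟩
  | succ n ihn =>
    obtain ⟨h1, h2⟩ := ihn (by omega)
    have h3 : ∀ b < 3, ((iter (fun k e' => p.run (e'.setv i k)) n e).setv i n).v b ≤ q := by
      intro b hb
      rw [Env.setv_v, if_neg (by omega)]
      exact h1 b hb
    refine ⟨fun b hb => ?_, ?_⟩
    · rw [iter, hp.run_v _ hb]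
      exact h3 b hb
    · rw [Nat.succ_mul, ← Nat.add_assoc]
      exact hrun _ _ h3 (h2.setv _ (by omega))

theorem Stmt.bounded_run (p : Stmt) (hl : p.loopsOk = true) (hp : p.protectsBounds)
    {q M : ℕ} {e : Env} (hq : ∀ b < 3, e.v b ≤ q) (h : e.Bounded M) :
    (p.run e).Bounded (M + p.growth.eval q) := by
  induction p generalizing M e with
  | skip => simpa [Stmt.growth, Stmt.run] using h
  | op o => simpa [Stmt.growth, Stmt.run] using o.bounded_run h
  | seq p r ihp ihr =>
    simp only [Stmt.loopsOk, Bool.and_eq_true] at hl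
    have hp1 : p.protectsBounds := fun x hx => hp x (List.mem_append_left _ hx)
    have hp2 : r.protectsBounds := fun x hx => hp x (List.mem_append_right _ hx)
    rw [Stmt.growth, Polynomial.eval_add, ← Nat.add_assoc]
    exact ihr hl.2 hp2 (fun b hb => by rw [hp1.run_v e hb]; exact hq b hb) (ihp hl.1 hp1 hq h)
  | ifPos x p r ihp ihr =>
    simp only [Stmt.loopsOk, Bool.and_eq_true] at hl
    have hp1 : p.protectsBounds := fun x hx => hp x (List.mem_append_left _ hx)
    have hp2 : r.protectsBounds := fun x hx => hp x (List.mem_append_right _ hx)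
    rw [Stmt.growth, Polynomial.eval_add, Stmt.run]
    split_ifs
    · exact (ihp hl.1 hp1 hq h).mono (by omega)
    · exact (ihr hl.2 hp2 hq h).mono (by omega)
  | loop i b p ih =>
    simp only [Stmt.loopsOk, Bool.and_eq_true, decide_eq_true_eq] at hl
    have hp1 : p.protectsBounds := fun x hx => hp x (List.mem_cons_of_mem _ hx)
    have hi : 3 ≤ i := hp i List.mem_cons_self
    have key := iter_bounds hp1 hi (fun M e' => ih hl.2 hp1) hq h ((h.v b).trans (Nat.le_succ M))
    rw [Stmt.growth, Polynomial.eval_mul, Polynomial.eval_X]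
    exact key.2.mono (Nat.add_le_add_left (Nat.mul_le_mul_right _ (hq b hl.1)) _)

/-! #### Compilation -/

/-- A straight-line program. -/
def block : List Instr → Prog
  | [] => .skip
  | a :: l => .seq (.instr a) (block l)

/-- The effect of a straight-line program. -/
def blockEffect : List Instr → State → State
  | [], s => s
  | a :: l, s => blockEffect l (a.effect s)

/-- The cost of a straight-line program. -/
def blockCost : List Instr → State → ℕ
  | [], _ => 1
  | a :: l, s => a.cost s + blockCost l (a.effect s)

theorem exec_block (l : List Instr) (s : State) :
    Exec (block l) s (blockCost l s) (blockEffect l s) := by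
  induction l generalizing s with
  | nil => exact .skip s
  | cons a l ih => exact .seq (.instr a s) (ih _)

/-- The register that holds a variable. -/
def varReg (x : ℕ) : ℕ := 8 * x + 5

/-- The registers that hold the loop counters. -/
def ctrReg (x : ℕ) : ℕ := 8 * x + 6

/-- The loop program state that is represented by a machine state. -/
def absState (s : State) : Env :=
  ⟨fun x => s.reg (8 * x + 5), fun k i => s.reg (8 * i + k), s.inp, s.out⟩

/-- The code that computes in register `7` the address of `A_k[y]`. -/
def addrCode (k : Fin 5) (y : ℕ) : List Instr :=
  [.add 7 (varReg y) (varReg y), .add 7 7 7, .add 7 7 7, .const 15 k, .add 7 7 15]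

/-- The code of an elementary operation. -/
def Op.code : Op → List Instr
  | .const x c => [.const (varReg x) c]
  | .inc x y => [.const 7 1, .add (varReg x) (varReg y) 7]
  | .copy x y => [.const 7 0, .add (varReg x) (varReg y) 7]
  | .sub x y z => [.sub (varReg x) (varReg y) (varReg z)]
  | .get x k y => addrCode k y ++ [.load (varReg x) 7]
  | .set k y x => addrCode k y ++ [.store 7 (varReg x)]
  | .read x => [.read (varReg x)]
  | .print x => [.print (varReg x)]

/-- The code of a loop program inside `d` loops. -/
def Stmt.code (d : ℕ) : Stmt → Prog
  | .skip => .skip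
  | .op o => block o.code
  | .seq p q => .seq (p.code d) (q.code d)
  | .ifPos x p q => .ifPos (varReg x) (p.code d) (q.code d)
  | .loop i b p =>
    .seq (block [.const 7 0, .add (ctrReg (2 * d)) (varReg b) 7, .const (ctrReg (2 * d + 1)) 0])
      (.whilePos (ctrReg (2 * d))
        (.seq (block [.const 7 0, .add (varReg i) (ctrReg (2 * d + 1)) 7])
          (.seq (p.code (d + 1))
            (block [.const 7 1, .add (ctrReg (2 * d + 1)) (ctrReg (2 * d + 1)) 7,
              .sub (ctrReg (2 * d)) (ctrReg (2 * d)) 7]))))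

theorem len_mono : Monotone len := fun _ _ h => Nat.succ_le_succ (Nat.size_le_size h)

/-- The cost of handling one number, if the variables are at most `M`. -/
def unitCost (M : ℕ) : ℕ := len (8 * M + 8)

theorem unitCost_mono : Monotone unitCost := fun _ _ h => len_mono (by omega)

theorem len_le_unitCost {x M : ℕ} (h : x ≤ 8 * M + 8) : len x ≤ unitCost M := len_mono h

theorem one_le_unitCost (M : ℕ) : 1 ≤ unitCost M := Nat.succ_le_succ (Nat.zero_le _)

theorem absState_update_var (f : ℕ → ℕ) (l o : List ℕ) (x n : ℕ) :
    absState ⟨Function.update f (8 * x + 5) n, l, o⟩ = (absState ⟨f, l, o⟩).setv x n := by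
  simp only [absState, Env.setv, Env.mk.injEq, and_true]
  constructor
  · funext y
    simp only [Function.update_apply]
    grind
  · funext k i
    have := k.isLt
    rw [Function.update_of_ne (by omega)]

theorem absState_update_arr (f : ℕ → ℕ) (l o : List ℕ) (k : Fin 5) (i n : ℕ) :
    absState ⟨Function.update f (8 * i + k) n, l, o⟩ = (absState ⟨f, l, o⟩).seta k i n := by
  have := k.isLt
  simp only [absState, Env.seta, Env.mk.injEq, and_true]
  constructor
  · funext y
    rw [Function.update_of_ne (by omega)]
  · funext l j
    have := l.isLt
    by_cases h : l = k
    · subst h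
      simp only [Function.update_self, Function.update_apply]
      grind
    · rw [Function.update_of_ne h, Function.update_of_ne]
      intro h'
      exact h (Fin.ext (by omega))

/-- Modulo 8, residues 0 to 4 hold the arrays, 5 the variables, 6 the loop counters and 7 the
scratch registers; the last two kinds are invisible to the abstraction. -/
theorem absState_update_aux (f : ℕ → ℕ) (l o : List ℕ) {r : ℕ} (n : ℕ) (hr : 6 ≤ r % 8) :
    absState ⟨Function.update f r n, l, o⟩ = absState ⟨f, l, o⟩ := by
  simp only [absState, Env.mk.injEq, and_true]
  constructor
  · funext y
    rw [Function.update_of_ne (by omega)]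
  · funext l j
    have := l.isLt
    rw [Function.update_of_ne (by omega)]

theorem absState_update_seven (f : ℕ → ℕ) (l o : List ℕ) (n : ℕ) :
    absState ⟨Function.update f 7 n, l, o⟩ = absState ⟨f, l, o⟩ :=
  absState_update_aux f l o n (by norm_num)

theorem absState_update_fifteen (f : ℕ → ℕ) (l o : List ℕ) (n : ℕ) :
    absState ⟨Function.update f 15 n, l, o⟩ = absState ⟨f, l, o⟩ :=
  absState_update_aux f l o n (by norm_num)

theorem absState_update_ctr (f : ℕ → ℕ) (l o : List ℕ) (j n : ℕ) :
    absState ⟨Function.update f (ctrReg j) n, l, o⟩ = absState ⟨f, l, o⟩ :=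
  absState_update_aux f l o n (by simp only [ctrReg]; omega)

theorem absState_addrCode (k : Fin 5) (y : ℕ) (s : State) :
    absState (blockEffect (addrCode k y) s) = absState s ∧
      (blockEffect (addrCode k y) s).reg 7 = 8 * (absState s).v y + k := by
  constructor
  · simp only [addrCode, blockEffect, Instr.effect, absState_update_seven,
      absState_update_fifteen]
  · simp [addrCode, blockEffect, Instr.effect, absState, varReg]
    ring

theorem blockEffect_append (l l' : List Instr) (s : State) :
    blockEffect (l ++ l') s = blockEffect l' (blockEffect l s) := by
  induction l generalizing s with
  | nil => rfl
  | cons a l ih => exact ih _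

theorem absState_code (o : Op) (s : State) :
    absState (blockEffect o.code s) = o.run (absState s) := by
  cases o with
  | set k y x =>
    obtain ⟨h1, h2⟩ := absState_addrCode k y s
    rw [Op.code, blockEffect_append, Op.run, ← h1]
    simp only [blockEffect, Instr.effect, h2, absState_update_arr, h1]
    rw [← h1]
    rfl
  | get x k y =>
    obtain ⟨h1, h2⟩ := absState_addrCode k y s
    rw [Op.code, blockEffect_append, Op.run]
    simp only [blockEffect, Instr.effect, varReg, h2, absState_update_var, h1]
    congr 1
    exact congrFun (congrFun (congrArg Env.a h1) k) _
  | const x c => simp only [Op.code, blockEffect, Instr.effect, Op.run, varReg, absState_update_var]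
  | inc x y =>
    simp only [Op.code, blockEffect, Instr.effect, Op.run, varReg, absState_update_var,
      absState_update_seven, Function.update_self]
    rw [Function.update_of_ne (by omega)]
    rfl
  | copy x y =>
    simp only [Op.code, blockEffect, Instr.effect, Op.run, varReg, absState_update_var,
      absState_update_seven, Function.update_self]
    rw [Function.update_of_ne (by omega)]
    rfl
  | sub x y z =>
    simp only [Op.code, blockEffect, Instr.effect, Op.run, varReg, absState_update_var]
    rfl
  | read x =>
    simp only [Op.code, blockEffect, Instr.effect, Op.run, varReg]
    rw [absState_update_var]; rfl
  | print x => rfl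

/-- Elementary code writes only to residues 0 to 5 and 7 modulo 8, so it cannot disturb the
bookkeeping of enclosing loops. -/
theorem blockEffect_code_ctr (o : Op) (s : State) (j : ℕ) :
    (blockEffect o.code s).reg (ctrReg j) = s.reg (ctrReg j) := by
  cases o with
  | set k y x =>
    obtain ⟨h1, h2⟩ := absState_addrCode k y s
    rw [Op.code, blockEffect_append]
    simp only [blockEffect, Instr.effect, h2]
    rw [Function.update_of_ne (by have := k.isLt; simp only [ctrReg]; omega)]
    simp only [addrCode, blockEffect, Instr.effect, ctrReg]
    iterate 5 rw [Function.update_of_ne (by omega)]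
  | _ =>
    simp only [Op.code, addrCode, List.cons_append, List.nil_append, blockEffect, Instr.effect,
      ctrReg, varReg]
    repeat rw [Function.update_of_ne (by omega)]

/-- The extra 1 arises because each separate block ends with its own `skip`. -/
theorem blockCost_append (l l' : List Instr) (s : State) :
    blockCost (l ++ l') s + 1 = blockCost l s + blockCost l' (blockEffect l s) := by
  induction l generalizing s with
  | nil => exact Nat.add_comm _ _
  | cons a l ih =>
    have := ih (a.effect s)
    simp only [List.cons_append, blockCost, blockEffect]
    omega

theorem blockCost_addrCode (k : Fin 5) (y : ℕ) (s : State) {M : ℕ}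
    (h : (absState s).Bounded M) : blockCost (addrCode k y) s ≤ 11 * unitCost M := by
  have hv : ∀ x, s.reg (8 * x + 5) ≤ M := h.v
  have h1 := one_le_unitCost M
  have hl : ∀ x, x ≤ 8 * M + 8 → len x ≤ unitCost M := fun x => len_le_unitCost
  have := k.isLt
  have e1 := hl (s.reg (8 * y + 5)) (by have := hv y; omega)
  have e2 := hl (s.reg (8 * y + 5) + s.reg (8 * y + 5)) (by have := hv y; omega)
  have e3 := hl (s.reg (8 * y + 5) + s.reg (8 * y + 5) +
    (s.reg (8 * y + 5) + s.reg (8 * y + 5))) (by have := hv y; omega)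
  have e4 := hl (s.reg (8 * y + 5) + s.reg (8 * y + 5) +
    (s.reg (8 * y + 5) + s.reg (8 * y + 5)) + (s.reg (8 * y + 5) + s.reg (8 * y + 5) +
    (s.reg (8 * y + 5) + s.reg (8 * y + 5)))) (by have := hv y; omega)
  have e7 := hl k (by omega)
  simp [addrCode, blockCost, Instr.effect, Instr.cost, varReg]
  omega

/-- Every number handled, including a computed address `8 * i + k` with `k < 5`, is at most `8 * M +
8` for the enlarged bound, so each costs one unit. The factor 16 is generous. -/
theorem blockCost_code (o : Op) (s : State) {M : ℕ} (h : (absState s).Bounded M) :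
    blockCost o.code s ≤ 16 * unitCost (M + o.growth) := by
  have hv : ∀ x, s.reg (8 * x + 5) ≤ M := h.v
  have ha : ∀ (k : Fin 5) i, s.reg (8 * i + k) ≤ M := h.a
  have hi : s.inp.headD 0 ≤ M := h.headD
  have h1 := one_le_unitCost (M + o.growth)
  have hl : ∀ x, x ≤ 8 * (M + o.growth) + 8 → len x ≤ unitCost (M + o.growth) :=
    fun x => len_le_unitCost
  cases o with
  | set k y x =>
    have := k.isLt
    obtain ⟨h1, h2⟩ := absState_addrCode k y s
    have h3 := blockCost_append (addrCode k y) [.store 7 (varReg x)] s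
    have h4 := blockCost_addrCode k y s h
    have h5 := hl _ (((congrArg (fun e => e.v x) h1).trans_le (h.v x)).trans (by omega))
    have h6 := hl _ (h2.trans_le (by have := h.v y; omega))
    have h7 := unitCost_mono (Nat.le_add_right M (Op.set k y x).growth)
    change blockCost (addrCode k y ++ [.store 7 (varReg x)]) s ≤ _
    simp only [blockCost, Instr.cost] at h3
    simp only [absState] at h5
    simp only [varReg] at *
    omega
  | get x k y =>
    have := k.isLt
    obtain ⟨h1, h2⟩ := absState_addrCode k y s
    have h3 := blockCost_append (addrCode k y) [.load (varReg x) 7] s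
    have h4 := blockCost_addrCode k y s h
    have h5 := hl _ (((congrArg (fun e => e.a k ((absState s).v y)) h1).trans_le
      (h.a k _)).trans (by omega))
    have h6 := hl _ (h2.trans_le (by have := h.v y; omega))
    have h7 := unitCost_mono (Nat.le_add_right M (Op.get x k y).growth)
    change blockCost (addrCode k y ++ [.load (varReg x) 7]) s ≤ _
    simp only [blockCost, Instr.cost, h2] at h3
    rw [h2] at h6
    simp only [absState] at h5 h3 h6
    omega
  | const x c =>
    have := hl c (by simp [Op.growth]; omega)
    simp only [Op.code, blockCost, Instr.cost]
    omega
  | inc x y =>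
    have := hl 1 (by omega)
    have := hl (s.reg (8 * y + 5)) (by have := hv y; omega)
    have : 8 * y ≠ 2 := by omega
    simp only [Op.code, blockCost, Instr.effect, Instr.cost, varReg, Function.update_apply]
    simp only [Nat.reduceEqDiff, this, if_false, if_true]
    omega
  | copy x y =>
    have := hl 0 (by omega)
    have := hl (s.reg (8 * y + 5)) (by have := hv y; omega)
    have : 8 * y ≠ 2 := by omega
    simp only [Op.code, blockCost, Instr.effect, Instr.cost, varReg, Function.update_apply]
    simp only [Nat.reduceEqDiff, this, if_false, if_true]
    omega
  | sub x y z =>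
    have := hl (s.reg (8 * z + 5)) (by have := hv z; omega)
    have := hl (s.reg (8 * y + 5)) (by have := hv y; omega)
    simp only [Op.code, blockCost, Instr.cost, varReg]
    omega
  | read x =>
    have := hl (s.inp.headD 0) (by omega)
    simp only [Op.code, blockCost, Instr.cost]
    omega
  | print x =>
    have := hl (s.reg (8 * x + 5)) (by have := hv x; omega)
    simp only [Op.code, blockCost, Instr.cost, varReg]
    omega

/-- A bound on the cost of a loop program in units of `unitCost`, if the loop bounds are
at most `X`. -/
noncomputable def Stmt.cost : Stmt → Polynomial ℕ
  | .skip => 1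
  | .op _ => 16
  | .seq p q => p.cost + q.cost
  | .ifPos _ p q => 1 + p.cost + q.cost
  | .loop _ _ p => 20 + Polynomial.X * (p.cost + 20)

theorem blockCost_loop_body {s : State} {M : ℕ} {i c : ℕ} (hc : s.reg (ctrReg c) ≤ M) :
    blockCost [.const 7 0, .add (varReg i) (ctrReg c) 7] s ≤ 4 * unitCost M := by
  have h1 := one_le_unitCost M
  have e0 := len_le_unitCost (x := 0) (M := M) (by omega)
  have e1 := len_le_unitCost (x := s.reg (ctrReg c)) (M := M) (by omega)
  have : 8 * c + 6 ≠ 7 := by omega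
  simp only [ctrReg] at *
  simp only [blockCost, Instr.effect, Instr.cost, Function.update_apply, this, if_false, if_true]
  omega

theorem blockCost_loop_tail {s : State} {M : ℕ} {r c : ℕ} (hr : s.reg (ctrReg r) ≤ M)
    (hc : s.reg (ctrReg c) ≤ M) (hrc : r ≠ c) :
    blockCost [.const 7 1, .add (ctrReg c) (ctrReg c) 7, .sub (ctrReg r) (ctrReg r) 7] s
      ≤ 6 * unitCost M := by
  have h1 := one_le_unitCost M
  have e0 := len_le_unitCost (x := 1) (M := M) (by omega)
  have e1 := len_le_unitCost (x := s.reg (ctrReg c)) (M := M) (by omega)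
  have e2 := len_le_unitCost (x := s.reg (ctrReg r)) (M := M) (by omega)
  have h3 : 8 * c + 6 ≠ 7 := by omega
  have h4 : 8 * r + 6 ≠ 7 := by omega
  have h5 : 8 * r + 6 ≠ 8 * c + 6 := by omega
  simp only [ctrReg] at *
  simp only [blockCost, Instr.effect, Instr.cost, Function.update_apply, h3, h4, h5, h3.symm,
    if_false, if_true]
  omega

theorem blockCost_loop_head {s : State} {M : ℕ} {b r c : ℕ} (hb : s.reg (varReg b) ≤ M) :
    blockCost [.const 7 0, .add (ctrReg r) (varReg b) 7, .const (ctrReg c) 0] s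
      ≤ 5 * unitCost M := by
  have h1 := one_le_unitCost M
  have e0 := len_le_unitCost (x := 0) (M := M) (by omega)
  have e1 := len_le_unitCost (x := s.reg (varReg b)) (M := M) (by omega)
  have h3 : 8 * b + 5 ≠ 7 := by omega
  simp only [varReg] at *
  simp only [blockCost, Instr.effect, Instr.cost, Function.update_apply, h3, if_false, if_true]
  omega

/-- The compiled program does what it should, at the cost that is announced. -/
theorem Stmt.exec_code (p : Stmt) (hl : p.loopsOk = true) (hp : p.protectsBounds) (d : ℕ)
    {q M : ℕ} {s : State} (hq : ∀ b < 3, (absState s).v b ≤ q) (h : (absState s).Bounded M) :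
    ∃ t s', Exec (p.code d) s t s' ∧ absState s' = p.run (absState s) ∧
      (∀ j < 2 * d, s'.reg (ctrReg j) = s.reg (ctrReg j)) ∧
      t ≤ p.cost.eval q * unitCost (M + p.growth.eval q) := by
  induction p generalizing M s d with
  | skip =>
    refine ⟨1, s, .skip s, rfl, fun _ _ => rfl, ?_⟩
    simpa [Stmt.cost] using one_le_unitCost _
  | op o =>
    refine ⟨_, _, exec_block _ s, absState_code o s, fun j _ => blockEffect_code_ctr o s j, ?_⟩
    simpa [Stmt.cost, Stmt.growth] using blockCost_code o s h
  | seq p r ihp ihr =>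
    simp only [Stmt.loopsOk, Bool.and_eq_true] at hl
    have hp1 : p.protectsBounds := fun x hx => hp x (List.mem_append_left _ hx)
    have hp2 : r.protectsBounds := fun x hx => hp x (List.mem_append_right _ hx)
    obtain ⟨t1, s1, ex1, ab1, fr1, c1⟩ := ihp hl.1 hp1 d hq h
    obtain ⟨t2, s2, ex2, ab2, fr2, c2⟩ := ihr hl.2 hp2 d
      (fun b hb => by rw [ab1, hp1.run_v _ hb]; exact hq b hb)
      (by rw [ab1]; exact p.bounded_run hl.1 hp1 hq h)
    refine ⟨_, s2, .seq ex1 ex2, by rw [ab2, ab1]; rfl,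
      fun j hj => (fr2 j hj).trans (fr1 j hj), ?_⟩
    rw [Stmt.cost, Stmt.growth, Polynomial.eval_add, Polynomial.eval_add, add_mul, ← add_assoc]
    exact Nat.add_le_add (c1.trans (Nat.mul_le_mul_left _ (unitCost_mono (by omega)))) c2
  | ifPos x p r ihp ihr =>
    simp only [Stmt.loopsOk, Bool.and_eq_true] at hl
    have hp1 : p.protectsBounds := fun x hx => hp x (List.mem_append_left _ hx)
    have hp2 : r.protectsBounds := fun x hx => hp x (List.mem_append_right _ hx)
    have hx : len (s.reg (varReg x)) ≤ unitCost (M + (p.growth + r.growth).eval q) :=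
      len_le_unitCost (by have := h.v x; simp only [absState] at this; simp only [varReg]; omega)
    have hm1 : M + p.growth.eval q ≤ M + (p.growth + r.growth).eval q := by
      rw [Polynomial.eval_add]; omega
    have hm2 : M + r.growth.eval q ≤ M + (p.growth + r.growth).eval q := by
      rw [Polynomial.eval_add]; omega
    rw [Stmt.cost, Stmt.growth, Polynomial.eval_add, Polynomial.eval_add, Polynomial.eval_one,
      add_mul, add_mul, one_mul, Stmt.run]
    by_cases h0 : 0 < (absState s).v x
    · obtain ⟨t1, s1, ex1, ab1, fr1, c1⟩ := ihp hl.1 hp1 d hq h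
      refine ⟨_, s1, .ifTrue h0 ex1, by rw [if_pos h0, ab1], fr1, ?_⟩
      have := c1.trans (Nat.mul_le_mul_left _ (unitCost_mono hm1))
      omega
    · obtain ⟨t1, s1, ex1, ab1, fr1, c1⟩ := ihr hl.2 hp2 d hq h
      refine ⟨_, s1, .ifFalse (Nat.eq_zero_of_not_pos h0) ex1, by rw [if_neg h0, ab1], fr1, ?_⟩
      have := c1.trans (Nat.mul_le_mul_left _ (unitCost_mono hm2))
      omega
  | loop i b p ih =>
    simp only [Stmt.loopsOk, Bool.and_eq_true, decide_eq_true_eq] at hl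
    have hp1 : p.protectsBounds := fun x hx => hp x (List.mem_cons_of_mem _ hx)
    have hi : 3 ≤ i := hp i List.mem_cons_self
    set e := absState s with he
    set B := e.v b with hB
    set f : ℕ → Env → Env := fun k e' => p.run (e'.setv i k) with hf
    set g := p.growth.eval q with hg
    set U := unitCost (M + q * g) with hU
    have hBM : B ≤ M := h.v b
    have hBq : B ≤ q := hq b hl.1
    have hMU : M ≤ M + q * g := Nat.le_add_right _ _
    have hU1 : 1 ≤ U := one_le_unitCost _
    -- Invariant with `k` rounds done and `r` to go. Both numbers live in counter registers, out of
    -- reach of the loop body, which may even overwrite its own loop variable.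
    have hwhile : ∀ r k (s : State), k + r = B → s.reg (ctrReg (2 * d)) = r →
        s.reg (ctrReg (2 * d + 1)) = k → absState s = iter f k e →
        ∃ t s', Exec (.whilePos (ctrReg (2 * d))
          (.seq (block [.const 7 0, .add (varReg i) (ctrReg (2 * d + 1)) 7])
            (.seq (p.code (d + 1))
              (block [.const 7 1, .add (ctrReg (2 * d + 1)) (ctrReg (2 * d + 1)) 7,
                .sub (ctrReg (2 * d)) (ctrReg (2 * d)) 7])))) s t s' ∧
          absState s' = iter f B e ∧
          (∀ j < 2 * d, s'.reg (ctrReg j) = s.reg (ctrReg j)) ∧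
          t ≤ (r * (p.cost.eval q + 20) + 1) * U := by
      intro r
      induction r with
      | zero =>
        intro k s hk h1 h2 h3
        refine ⟨_, s, .whileFalse h1, by rw [h3, ← hk]; rfl, fun _ _ => rfl, ?_⟩
        rw [h1, zero_mul, zero_add, one_mul]
        exact len_le_unitCost (by omega)
      | succ r ihr =>
        intro k s hk h1 h2 h3
        obtain ⟨b1, b2⟩ := iter_bounds hp1 hi (fun M e' => p.bounded_run hl.2 hp1) hq h
          (n := k) (by omega)
        have hkq : M + k * g ≤ M + q * g :=
          Nat.add_le_add_left (Nat.mul_le_mul_right _ (by omega)) _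
        have hkq' : M + k * g + g ≤ M + q * g := by
          rw [Nat.add_assoc, ← Nat.succ_mul]
          exact Nat.add_le_add_left (Nat.mul_le_mul_right _ (by omega)) _
        set l1 : List Instr := [.const 7 0, .add (varReg i) (ctrReg (2 * d + 1)) 7] with hl1
        set l2 : List Instr := [.const 7 1, .add (ctrReg (2 * d + 1)) (ctrReg (2 * d + 1)) 7,
                .sub (ctrReg (2 * d)) (ctrReg (2 * d)) 7] with hl2
        have c1 : blockCost l1 s ≤ 4 * U :=
          (blockCost_loop_body (M := M) (by omega)).trans
            (Nat.mul_le_mul_left _ (unitCost_mono hMU))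
        have a1 : absState (blockEffect l1 s) = (iter f k e).setv i k := by
          rw [← h3, ← h2]
          simp only [hl1, blockEffect, Instr.effect, varReg, ctrReg, absState_update_var,
            absState_update_seven, Function.update_self]
          rw [Function.update_of_ne (by omega), Nat.add_zero]
        have f1 : ∀ j, (blockEffect l1 s).reg (ctrReg j) = s.reg (ctrReg j) := by
          intro j
          simp only [hl1, blockEffect, Instr.effect, varReg, ctrReg]
          rw [Function.update_of_ne (by omega), Function.update_of_ne (by omega)]
        obtain ⟨t2, s2, ex2, ab2, fr2, c2⟩ := ih hl.2 hp1 (d + 1) (s := blockEffect l1 s)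
          (M := M + k * g) (by
            intro b hb
            rw [a1, Env.setv_v, if_neg (by omega)]
            exact b1 b hb) (by rw [a1]; exact b2.setv _ (by omega))
        -- The body is compiled at depth `d + 1` and preserves all counters below `2 * d + 2`, in
        -- particular the two of this loop.
        have r1 : s2.reg (ctrReg (2 * d)) = r + 1 := by rw [fr2 _ (by omega), f1, h1]
        have r2 : s2.reg (ctrReg (2 * d + 1)) = k := by rw [fr2 _ (by omega), f1, h2]
        have c3 : blockCost l2 s2 ≤ 6 * U :=
          (blockCost_loop_tail (M := M) (by omega) (by omega) (by omega)).trans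
            (Nat.mul_le_mul_left _ (unitCost_mono hMU))
        obtain ⟨t4, s4, ex4, ab4, fr4, c4⟩ := ihr (k + 1) (blockEffect l2 s2) (by omega)
          (by
            simp only [hl2, blockEffect, Instr.effect, Function.update_self]
            rw [Function.update_of_ne (by simp only [ctrReg]; omega),
              Function.update_of_ne (by simp only [ctrReg]; omega),
              Function.update_of_ne (by simp only [ctrReg]; omega), Function.update_self, r1]
            rfl)
          (by
            simp only [hl2, blockEffect, Instr.effect]
            rw [Function.update_of_ne (by simp only [ctrReg]; omega), Function.update_self,
              Function.update_of_ne (by simp only [ctrReg]; omega), Function.update_self, r2])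
          (by
            simp only [hl2, blockEffect, Instr.effect, absState_update_ctr,
              absState_update_seven]
            rw [show absState ⟨s2.reg, s2.inp, s2.out⟩ = absState s2 from rfl, ab2, a1]
            rfl)
        refine ⟨_, s4, .whileTrue (by omega)
          (.seq (exec_block l1 s) (.seq ex2 (exec_block l2 s2))) ex4, ab4, ?_, ?_⟩
        · intro j hj
          rw [fr4 j hj, ← f1 j, ← fr2 j (by omega)]
          simp only [hl2, blockEffect, Instr.effect]
          iterate 3 rw [Function.update_of_ne (by simp only [ctrReg]; omega)]
        · have c0 : len (s.reg (ctrReg (2 * d))) ≤ U := len_le_unitCost (by omega)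
          have c2' : t2 ≤ p.cost.eval q * U :=
            c2.trans (Nat.mul_le_mul_left _ (unitCost_mono hkq'))
          -- The overhead of a round is 1 unit for the test, 4 for setting the loop variable and 6
          -- for updating the counters, within the 20 allotted.
          have : ((r + 1) * (p.cost.eval q + 20) + 1) * U =
            (r * (p.cost.eval q + 20) + 1) * U + p.cost.eval q * U + 20 * U := by ring
          omega
    set l0 : List Instr :=
      [.const 7 0, .add (ctrReg (2 * d)) (varReg b) 7, .const (ctrReg (2 * d + 1)) 0] with hl0
    have c0 : blockCost l0 s ≤ 5 * U :=
      (blockCost_loop_head (M := M) (h.v b)).trans (Nat.mul_le_mul_left _ (unitCost_mono hMU))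
    obtain ⟨t1, s1, ex1, ab1, fr1, c1⟩ := hwhile B 0 (blockEffect l0 s) (by omega)
      (by
        simp only [hl0, blockEffect, Instr.effect]
        rw [Function.update_of_ne (by simp only [ctrReg]; omega), Function.update_self,
          Function.update_of_ne (by simp only [varReg]; omega), Function.update_self]
        rfl)
      (by simp only [hl0, blockEffect, Instr.effect, Function.update_self])
      (by
        simp only [hl0, blockEffect, Instr.effect, absState_update_ctr, absState_update_seven]
        rfl)
    refine ⟨_, s1, .seq (exec_block l0 s) ex1, ab1, ?_, ?_⟩
    · intro j hj
      rw [fr1 j hj]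
      simp only [hl0, blockEffect, Instr.effect]
      iterate 3 rw [Function.update_of_ne (by simp only [ctrReg]; omega)]
    · rw [Stmt.cost, Stmt.growth]
      simp only [Polynomial.eval_add, Polynomial.eval_mul, Polynomial.eval_X,
        Polynomial.eval_ofNat]
      have h1 : (B * (p.cost.eval q + 20) + 1) * U ≤ (q * (p.cost.eval q + 20) + 1) * U :=
        Nat.mul_le_mul_right _ (Nat.succ_le_succ (Nat.mul_le_mul_right _ hBq))
      have h2 : (20 + q * (p.cost.eval q + 20)) * U =
        (q * (p.cost.eval q + 20) + 1) * U + 19 * U := by ring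
      rw [← hg, ← hU, h2]
      omega

/-! ### From unit costs to a polynomial in the input size -/

/-- The code of a sequence of elementary operations. -/
def opsCode : List Op → Prog
  | [] => .skip
  | o :: l => .seq (block o.code) (opsCode l)

/-- Straight-line code is treated apart because the opening operations assign the variables `0, 1,
2`, which loop programs must leave alone. -/
theorem exec_opsCode (l : List Op) {M : ℕ} {s : State} (h : (absState s).Bounded M) :
    ∃ t s', Exec (opsCode l) s t s' ∧ absState s' = l.foldl Op.run (absState s) ∧
      (absState s').Bounded (M + (l.map Op.growth).sum) ∧
      t ≤ (16 * l.length + 1) * unitCost (M + (l.map Op.growth).sum) := by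
  induction l generalizing M s with
  | nil => exact ⟨1, s, .skip s, rfl, by simpa using h, by simpa using one_le_unitCost _⟩
  | cons o l ih =>
    have h1 := absState_code o s
    obtain ⟨t, s', ex, ab, bd, c⟩ := ih (by rw [h1]; exact o.bounded_run h)
    rw [Nat.add_assoc] at bd c
    refine ⟨_, s', .seq (exec_block _ s) ex, by rw [ab, h1]; rfl, bd, ?_⟩
    have h2 := (blockCost_code o s h).trans (Nat.mul_le_mul_left _ (unitCost_mono
      (show M + o.growth ≤ M + (o.growth + (l.map Op.growth).sum) by omega)))
    rw [List.map_cons, List.sum_cons, List.length_cons,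
      show 16 * (l.length + 1) + 1 = 16 + (16 * l.length + 1) by ring, add_mul]
    exact Nat.add_le_add h2 c

/-- This is where exponentially large values become affordable: a polynomial increase `K` over `2 ^
N` costs only `N + K + 6` per number. -/
theorem unitCost_two_pow (N K : ℕ) : unitCost (2 ^ N + K) ≤ N + K + 6 := by
  refine Nat.succ_le_succ (Nat.size_le.mpr ?_)
  have h1 : 2 ^ N ≤ 2 ^ (N + K) := Nat.pow_le_pow_right two_pos (Nat.le_add_right _ _)
  have h2 : K + 1 ≤ 2 ^ (N + K) := Nat.succ_le_of_lt
    (K.lt_two_pow_self.trans_le (Nat.pow_le_pow_right two_pos (Nat.le_add_left _ _)))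
  have h3 : 2 ^ (N + K + 5) = 32 * 2 ^ (N + K) := by ring
  omega

theorem length_le_inputSize (x : List ℕ) : x.length ≤ inputSize x := by
  induction x with
  | nil => simp
  | cons a l ih =>
    simp only [inputSize, List.map_cons, List.sum_cons, List.length_cons, len] at *
    omega

theorem lt_two_pow_inputSize {x : List ℕ} {a : ℕ} (ha : a ∈ x) : a ≤ 2 ^ inputSize x := by
  have h : len a ≤ inputSize x := List.single_le_sum (fun _ _ => Nat.zero_le _) _
    (List.mem_map_of_mem ha)
  exact (Nat.lt_size_self a).le.trans (Nat.pow_le_pow_right two_pos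
    ((Nat.le_succ _).trans h))

/-- Read the loop bounds `n` and `m` and compute the third loop bound, `n + 2`. -/
def boundsOps : List Op := [.read 0, .read 1, .inc 2 0, .inc 2 2]

/-- The state after reading the loop bounds. -/
def startEnv (n m : ℕ) (x : List ℕ) : Env :=
  ⟨fun i => if i = 0 then n else if i = 1 then m else if i = 2 then n + 2 else 0,
    fun _ _ => 0, x, []⟩

theorem foldl_boundsOps (n m : ℕ) (x : List ℕ) :
    boundsOps.foldl Op.run (absState (init (n :: m :: x))) = startEnv n m x := by
  simp only [boundsOps, List.foldl, Op.run, absState, init, startEnv, Env.setv, Env.next,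
    Env.mk.injEq, and_true, List.headD_cons, List.tail_cons]
  funext i
  simp only [Function.update_apply]
  split_ifs <;> simp_all

/-- A loop program runs in polynomial time on inputs whose first two numbers, the loop bounds, are
at most the length of the input. -/
theorem exists_polynomial_exec (p : Stmt) (hl : p.loopsOk = true) (hp : p.protectsBounds) :
    ∃ b : Polynomial ℕ, ∀ (n m : ℕ) (x : List ℕ), n ≤ (n :: m :: x).length →
      m ≤ (n :: m :: x).length → ∃ t s, Exec (.seq (opsCode boundsOps) (p.code 0))
        (init (n :: m :: x)) t s ∧ t ≤ b.eval (inputSize (n :: m :: x)) ∧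
        s.out = (p.run (startEnv n m x)).out := by
  -- `65 = 16 * 4 + 1` pays for the four opening operations, which raise values by at most 2, whence
  -- `X + 8`. The argument `X + 2` reflects the third loop bound `n + 2`.
  refine ⟨65 * (Polynomial.X + 8) + p.cost.comp (Polynomial.X + 2) *
    (Polynomial.X + 8 + p.growth.comp (Polynomial.X + 2)), fun n m x hn hm => ?_⟩
  set N := inputSize (n :: m :: x) with hN
  have hlen : (n :: m :: x).length ≤ N := length_le_inputSize _
  have hbd : (absState (init (n :: m :: x))).Bounded (2 ^ N) :=
    ⟨fun _ => Nat.zero_le _, fun _ _ => Nat.zero_le _, fun a ha => lt_two_pow_inputSize ha⟩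
  obtain ⟨t1, s1, ex1, ab1, bd1, c1⟩ := exec_opsCode boundsOps hbd
  rw [foldl_boundsOps] at ab1
  have hg : (boundsOps.map Op.growth).sum = 2 := rfl
  have hlb : boundsOps.length = 4 := rfl
  rw [hg] at bd1 c1
  obtain ⟨t2, s2, ex2, ab2, -, c2⟩ := p.exec_code hl hp 0 (q := N + 2) (s := s1) (by
    intro b hb
    rw [ab1]
    simp only [startEnv]
    split_ifs <;> omega) bd1
  refine ⟨_, s2, .seq ex1 ex2, ?_, by rw [← ab1, ← ab2]; rfl⟩
  simp only [Polynomial.eval_add, Polynomial.eval_mul, Polynomial.eval_comp, Polynomial.eval_X,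
    Polynomial.eval_ofNat]
  refine Nat.add_le_add (c1.trans ?_) (c2.trans ?_)
  · rw [hlb]
    exact Nat.mul_le_mul_left _ (unitCost_two_pow _ _)
  · refine Nat.mul_le_mul_left _ ?_
    rw [Nat.add_assoc]
    exact (unitCost_two_pow _ _).trans (by omega)

end RAM

/-! ### Greedy choice of a matchable set of colors -/

/-- The elements of `A` can be matched injectively with neighbors. -/
def Matchable (N : ℕ → Finset ℕ) (A : Finset ℕ) : Prop :=
  ∃ g : ℕ → ℕ, Set.InjOn g A ∧ ∀ c ∈ A, g c ∈ N c

namespace Matchable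

variable {N : ℕ → Finset ℕ}

theorem mono {A B : Finset ℕ} (h : Matchable N B) (hAB : A ⊆ B) : Matchable N A := by
  obtain ⟨g, hg, hN⟩ := h
  exact ⟨g, hg.mono (Finset.coe_subset.mpr hAB), fun c hc => hN c (hAB hc)⟩

theorem card_le {A : Finset ℕ} (h : Matchable N A) : A.card ≤ (A.biUnion N).card := by
  obtain ⟨g, hg, hN⟩ := h
  exact Finset.card_le_card_of_injOn g (fun c hc => Finset.mem_biUnion.mpr ⟨c, hc, hN c hc⟩) hg

/-- Hall's marriage theorem, applied to the family indexed by the subtype `A` and extended by an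
arbitrary value outside `A`. -/
theorem of_hall {A : Finset ℕ} (h : ∀ X ⊆ A, X.card ≤ (X.biUnion N).card) : Matchable N A := by
  obtain ⟨f, hf, hN⟩ := (Finset.all_card_le_biUnion_card_iff_exists_injective
    (fun c : A => N c)).mp fun s => by
      have := h (s.map (Function.Embedding.subtype _)) (by
        intro c hc
        obtain ⟨d, -, rfl⟩ := Finset.mem_map.mp hc
        exact d.2)
      rwa [Finset.card_map, Finset.map_eq_image, Finset.image_biUnion] at this
  refine ⟨fun c => if hc : c ∈ A then f ⟨c, hc⟩ else 0, fun c hc d hd hcd => ?_, fun c hc => ?_⟩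
  · rw [Finset.mem_coe] at hc hd
    simp only [hc, hd, dif_pos] at hcd
    exact congrArg Subtype.val (hf hcd)
  · simp only [hc, dif_pos]
    exact hN ⟨c, hc⟩

/-- A matchable subset of `P` that is maximal for inclusion has maximum size. -/
theorem card_le_of_maximal {A B P : Finset ℕ} (hA : Matchable N A)
    (hB : Matchable N B) (hBP : B ⊆ P) (hmax : ∀ c ∈ P \ A, ¬ Matchable N (insert c A)) :
    B.card ≤ A.card := by
  -- A rejected `c` violates Hall's condition in `insert c A`. Since `A` itself satisfies the
  -- condition, the violating set contains `c` and its neighborhood is no larger than its part in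
  -- `A`: it is tight.
  have hX : ∀ c ∈ P \ A, ∃ X : Finset ℕ, c ∈ X ∧ (X.biUnion N).card ≤ (X ∩ A).card := by
    intro c hc
    by_contra! hcon
    refine hmax c hc (of_hall fun X hXA => ?_)
    by_cases hcX : c ∈ X
    · have h1 := hcon X hcX
      have h2 : X ⊆ insert c (X ∩ A) := by
        intro d hd
        have := hXA hd
        simp only [Finset.mem_insert, Finset.mem_inter] at *
        tauto
      have := (Finset.card_le_card h2).trans (Finset.card_insert_le _ _)
      omega
    · refine (hA.mono fun d hd => ?_).card_le
      exact (Finset.mem_insert.mp (hXA hd)).resolve_left fun h => hcX (h ▸ hd)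
  choose! F hF1 hF2 using hX
  -- Tightness survives unions: `X ↦ |N(X)|` is submodular and `X ↦ |X ∩ A|` is modular. The term
  -- for the intersection is controlled by `h5`, where matchability of `A` enters.
  have tight : ∀ Q ⊆ P \ A, ((Q.biUnion F).biUnion N).card ≤ (Q.biUnion F ∩ A).card := by
    intro Q
    induction Q using Finset.induction with
    | empty => simp
    | insert c Q hc ih =>
      intro hQ
      have h1 := ih fun d hd => hQ (Finset.mem_insert_of_mem hd)
      have h2 := hF2 c (hQ (Finset.mem_insert_self _ _))
      rw [Finset.biUnion_insert, Finset.union_biUnion, Finset.union_inter_distrib_right]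
      set X := F c
      set Y := Q.biUnion F
      have h3 := Finset.card_union_add_card_inter (X.biUnion N) (Y.biUnion N)
      have h4 := Finset.card_union_add_card_inter (X ∩ A) (Y ∩ A)
      have h5 : ((X ∩ A) ∩ (Y ∩ A)).card ≤ (X.biUnion N ∩ Y.biUnion N).card := by
        refine (hA.mono fun d hd => ?_).card_le.trans (Finset.card_le_card fun v hv => ?_)
        · exact (Finset.mem_inter.mp (Finset.mem_inter.mp hd).1).2
        · obtain ⟨d, hd, hdv⟩ := Finset.mem_biUnion.mp hv
          simp only [Finset.mem_inter] at hd
          exact Finset.mem_inter.mpr ⟨Finset.mem_biUnion.mpr ⟨d, hd.1.1, hdv⟩,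
            Finset.mem_biUnion.mpr ⟨d, hd.2.1, hdv⟩⟩
      omega
  have hT := tight (P \ A) subset_rfl
  set X := (P \ A).biUnion F with hXdef
  -- The union `X` of all tight sets contains `P \ A`. Inside `X`, the set `B` is limited by the
  -- neighborhood; outside `X`, it is contained in `A`.
  have h1 : (B ∩ X).card ≤ (X ∩ A).card :=
    ((hB.mono Finset.inter_subset_left).card_le.trans (Finset.card_le_card
      (Finset.biUnion_subset_biUnion_of_subset_left _ Finset.inter_subset_right))).trans hT
  have h2 : (B \ X).card ≤ (A \ X).card := by
    refine Finset.card_le_card fun c hc => ?_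
    obtain ⟨hcB, hcX⟩ := Finset.mem_sdiff.mp hc
    refine Finset.mem_sdiff.mpr ⟨by_contra fun hcA => hcX ?_, hcX⟩
    have := Finset.mem_sdiff.mpr ⟨hBP hcB, hcA⟩
    exact Finset.mem_biUnion.mpr ⟨c, this, hF1 c this⟩
  have h3 := Finset.card_inter_add_card_sdiff B X
  have h4 := Finset.card_inter_add_card_sdiff A X
  rw [Finset.inter_comm A X] at h4
  omega

end Matchable

/-! ### Weights compared threshold by threshold -/

theorem sum_eq_sum_card_filter_lt (w : ℕ → ℕ) (A : Finset ℕ) {T : ℕ} (hT : ∀ c ∈ A, w c ≤ T) :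
    ∑ c ∈ A, w c = ∑ t ∈ Finset.range T, (A.filter (t < w ·)).card := by
  simp only [Finset.card_filter]
  rw [Finset.sum_comm]
  refine Finset.sum_congr rfl fun c hc => ?_
  rw [← Finset.card_filter]
  have : (Finset.range T).filter (· < w c) = Finset.range (w c) := by
    ext t
    have := hT c hc
    simp only [Finset.mem_filter, Finset.mem_range]
    omega
  rw [this, Finset.card_range]

/-- A sum of weights is the sum over `t` of the number of elements heavier than `t`. Having no more
elements in total and at least as many light ones means having no more heavy ones at each level. -/
theorem sum_le_sum_of_card_filter_le {w : ℕ → ℕ} {A B : Finset ℕ} (hcard : A.card ≤ B.card)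
    (h : ∀ t, (B.filter (w · ≤ t)).card ≤ (A.filter (w · ≤ t)).card) :
    ∑ c ∈ A, w c ≤ ∑ c ∈ B, w c := by
  have hT : ∀ c ∈ A ∪ B, w c ≤ (A ∪ B).sup w := fun c hc => Finset.le_sup hc
  rw [sum_eq_sum_card_filter_lt w A fun c hc => hT c (Finset.mem_union_left _ hc),
    sum_eq_sum_card_filter_lt w B fun c hc => hT c (Finset.mem_union_right _ hc)]
  refine Finset.sum_le_sum fun t _ => ?_
  have h1 := Finset.card_filter_add_card_filter_not (s := A) (w · ≤ t)
  have h2 := Finset.card_filter_add_card_filter_not (s := B) (w · ≤ t)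
  simp only [not_le] at h1 h2
  have := h t
  omega

/-- `A` is a result of the greedy algorithm for matchable subsets of `P`. -/
structure IsGreedy (N : ℕ → Finset ℕ) (w : ℕ → ℕ) (P A : Finset ℕ) : Prop where
  matchable : Matchable N A
  subset : A ⊆ P
  rejected : ∀ c ∈ P, c ∉ A → ¬ Matchable N (insert c (A.filter (w · ≤ w c)))

namespace IsGreedy

variable {N : ℕ → Finset ℕ} {w : ℕ → ℕ} {P A : Finset ℕ}

/-- Below any threshold the greedy set is a maximal matchable subset of the candidates, since a
candidate was rejected on account of kept colors no heavier than itself. -/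
theorem card_filter_le (h : IsGreedy N w P A) {B : Finset ℕ} (hB : Matchable N B) (hBP : B ⊆ P)
    (t : ℕ) : (B.filter (w · ≤ t)).card ≤ (A.filter (w · ≤ t)).card := by
  refine Matchable.card_le_of_maximal (P := P.filter (w · ≤ t))
    (h.matchable.mono (Finset.filter_subset _ _)) (hB.mono (Finset.filter_subset _ _))
    (Finset.filter_subset_filter _ hBP) fun c hc hm => ?_
  simp only [Finset.mem_sdiff, Finset.mem_filter, not_and] at hc
  obtain ⟨⟨hcP, hct⟩, hcA⟩ := hc
  refine h.rejected c hcP (fun h => hcA h hct) (hm.mono (Finset.insert_subset_insert _ ?_))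
  exact Finset.monotone_filter_right _ fun d _ hd => hd.trans hct

theorem card_le (h : IsGreedy N w P A) {B : Finset ℕ} (hB : Matchable N B) (hBP : B ⊆ P) :
    B.card ≤ A.card := by
  refine Matchable.card_le_of_maximal h.matchable hB hBP fun c hc hm => ?_
  obtain ⟨hcP, hcA⟩ := Finset.mem_sdiff.mp hc
  exact h.rejected c hcP hcA (hm.mono (Finset.insert_subset_insert _ (Finset.filter_subset _ _)))

theorem sum_le (h : IsGreedy N w P A) {B : Finset ℕ} (hB : Matchable N B) (hBP : B ⊆ P)
    (hcard : A.card ≤ B.card) : ∑ c ∈ A, w c ≤ ∑ c ∈ B, w c :=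
  sum_le_sum_of_card_filter_le hcard (h.card_filter_le hB hBP)

theorem empty (N : ℕ → Finset ℕ) (w : ℕ → ℕ) : IsGreedy N w ∅ ∅ :=
  ⟨⟨id, by simp, by simp⟩, subset_rfl, by simp⟩

/-- Earlier rejections persist because unmatchability passes to larger sets. -/
theorem accept (h : IsGreedy N w P A) {j : ℕ} (hm : Matchable N (insert j A)) :
    IsGreedy N w (insert j P) (insert j A) := by
  refine ⟨hm, Finset.insert_subset_insert _ h.subset, fun c hc hcA hm' => ?_⟩
  rw [Finset.mem_insert, not_or] at hcA
  refine h.rejected c ((Finset.mem_insert.mp hc).resolve_left hcA.1) hcA.2 (hm'.mono ?_)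
  exact Finset.insert_subset_insert _ (Finset.filter_subset_filter _ (Finset.subset_insert _ _))

/-- As `j` is at least as heavy as all earlier candidates, restricting `A` to weights at most `w j`
removes nothing. -/
theorem reject (h : IsGreedy N w P A) {j : ℕ} (hw : ∀ c ∈ P, w c ≤ w j)
    (hm : ¬ Matchable N (insert j A)) : IsGreedy N w (insert j P) A := by
  refine ⟨h.matchable, h.subset.trans (Finset.subset_insert _ _), fun c hc hcA hm' => ?_⟩
  rcases Finset.mem_insert.mp hc with rfl | hc
  · rw [Finset.filter_true_of_mem fun d hd => hw d (h.subset hd)] at hm'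
    exact hm hm'
  · exact h.rejected c hc hcA hm'

end IsGreedy

/-! ### Matching by an auction -/

/-- The function `f` matches the elements of `A` with vertices below `n`; `m` means unmatched. -/
structure IsMatching (N : ℕ → Finset ℕ) (n m : ℕ) (A : Finset ℕ) (f : ℕ → ℕ) : Prop where
  le : ∀ v < n, f v ≤ m
  mem : ∀ v < n, f v ≠ m → v ∈ N (f v)
  inj : ∀ u < n, ∀ v < n, f u = f v → f u ≠ m → u = v
  none_notMem : m ∉ A
  mem_iff : ∀ c, c ≠ m → (c ∈ A ↔ ∃ v < n, f v = c)

theorem IsMatching.congr {N : ℕ → Finset ℕ} {n m : ℕ} {A : Finset ℕ} {f g : ℕ → ℕ}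
    (h : IsMatching N n m A f) (hfg : ∀ v < n, g v = f v) : IsMatching N n m A g := by
  refine ⟨fun v hv => hfg v hv ▸ h.le v hv, fun v hv => hfg v hv ▸ h.mem v hv,
    fun u hu v hv => hfg v hv ▸ hfg u hu ▸ h.inj u hu v hv, h.none_notMem, fun c hc => ?_⟩
  rw [h.mem_iff c hc]
  exact exists_congr fun v => and_congr_right fun hv => by rw [hfg v hv]

theorem IsMatching.matchable {N : ℕ → Finset ℕ} {n m : ℕ} {A : Finset ℕ} {f : ℕ → ℕ}
    (h : IsMatching N n m A f) : Matchable N A := by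
  have hA : ∀ c ∈ A, ∃ v, v < n ∧ f v = c := fun c hc =>
    (h.mem_iff c fun hcm => h.none_notMem (hcm ▸ hc)).mp hc
  choose! g hg1 hg2 using hA
  refine ⟨g, fun c hc d hd hcd => by rw [← hg2 c hc, ← hg2 d hd, hcd], fun c hc => ?_⟩
  have := h.mem (g c) (hg1 c hc)
  rw [hg2 c hc] at this
  exact this fun hcm => h.none_notMem (hcm ▸ hc)

/-- The state of an auction after `k` bids. The vertices below `n` and an additional vertex `n`,
which everybody is interested in, have owners `f` and prices `p`; `h` is the bidder who has no
vertex (`m` if there is none); `S` is the set of bidders. -/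
structure IsAuction (N : ℕ → Finset ℕ) (n m : ℕ) (S : Finset ℕ) (k : ℕ) (f p : ℕ → ℕ)
    (h : ℕ) : Prop where
  le : ∀ v ≤ n, f v ≤ m
  hand_le : h ≤ m
  mem : ∀ v < n, f v ≠ m → v ∈ N (f v)
  inj : ∀ u ≤ n, ∀ v ≤ n, f u = f v → f u ≠ m → u = v
  hand_ne : h ≠ m → ∀ v ≤ n, f v ≠ h
  none_notMem : m ∉ S
  mem_iff : ∀ c, c ≠ m → (c ∈ S ↔ c = h ∨ ∃ v ≤ n, f v = c)
  extra_free : h ≠ m → f n = m ∧ p n = n + 1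
  extra_taken : f n ≠ m → p n = n + 2
  price_free : ∀ v < n, f v = m → p v = 0
  slack : ∀ v ≤ n, f v ≠ m → ∀ u ∈ N (f v), p v ≤ p u + 1
  price_le : ∀ v ≤ n, p v ≤ n + 2
  sum_price : h ≠ m → ∑ v ∈ Finset.range n, p v = k

namespace IsAuction

variable {N : ℕ → Finset ℕ} {n m : ℕ} {S : Finset ℕ} {k : ℕ} {f p : ℕ → ℕ} {h : ℕ}

/-- All ordinary prices are 0, so the slack condition is trivial, and the new color `j` is the one
without a vertex. -/
theorem start {A : Finset ℕ} (hf : IsMatching N n m A f) {j : ℕ} (hj : j < m) (hjA : j ∉ A)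
    (hn : f n = m) (hp : ∀ v < n, p v = 0) (hpn : p n = n + 1) :
    IsAuction N n m (insert j A) 0 f p j where
  le v hv := by
    rcases hv.lt_or_eq with hv | rfl
    exacts [hf.le v hv, hn.le]
  hand_le := hj.le
  mem := hf.mem
  inj u hu v hv huv hum := by
    have hun : u < n := lt_of_le_of_ne hu fun h => hum (h ▸ hn)
    have hvn : v < n := lt_of_le_of_ne hv fun h => hum (huv.trans (h ▸ hn))
    exact hf.inj u hun v hvn huv hum
  hand_ne _ v hv hvj := by
    rcases hv.lt_or_eq with hv | rfl
    · exact hjA ((hf.mem_iff j hj.ne).mpr ⟨v, hv, hvj⟩)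
    · omega
  none_notMem hm := (Finset.mem_insert.mp hm).elim (fun h => by omega) hf.none_notMem
  mem_iff c hc := by
    rw [Finset.mem_insert, hf.mem_iff c hc]
    refine or_congr_right ⟨fun ⟨v, hv, h⟩ => ⟨v, hv.le, h⟩, fun ⟨v, hv, h⟩ => ⟨v, ?_, h⟩⟩
    exact lt_of_le_of_ne hv fun hvn => hc (by rw [← h, hvn, hn])
  extra_free _ := ⟨hn, hpn⟩
  extra_taken h := absurd hn h
  price_free v hv _ := hp v hv
  slack v hv hvm u _ := by
    rcases hv.lt_or_eq with hv | rfl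
    · rw [hp v hv]
      exact Nat.zero_le _
    · exact absurd hn hvm
  price_le v hv := by
    rcases hv.lt_or_eq with hv | rfl
    · rw [hp v hv]
      exact Nat.zero_le _
    · omega
  sum_price _ := Finset.sum_eq_zero fun v hv => hp v (Finset.mem_range.mp hv)

/-- The minimality of `p b` preserves slack for the new owner, and prices never fall, which
preserves it for the others. The comparison with the dummy price `n + 1` keeps prices at most `n +
2`. A previously free vertex, such as the dummy, leaves nobody evicted and ends the auction. -/
theorem bid (ha : IsAuction N n m S k f p h) (hh : h ≠ m) {b : ℕ} (hb : b = n ∨ b < n ∧ b ∈ N h)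
    (hbn : p b ≤ p n) (hmin : ∀ u ∈ N h, p b ≤ p u) :
    IsAuction N n m S (k + 1) (Function.update f b h) (Function.update p b (p b + 1)) (f b) where
  le v hv := by
    rw [Function.update_apply]
    split_ifs
    exacts [ha.hand_le, ha.le v hv]
  hand_le := ha.le b (by omega)
  mem v hv := by
    rw [Function.update_apply]
    split_ifs with hvb
    · intro _
      rw [hvb] at hv ⊢
      exact (hb.resolve_left (by omega)).2
    · exact ha.mem v hv
  inj u hu v hv := by
    have h1 := ha.inj u hu v hv
    have h2 := ha.hand_ne hh u hu
    have h3 := ha.hand_ne hh v hv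
    simp only [Function.update_apply]
    split_ifs with hub hvb hvb
    · exact fun _ _ => hub.trans hvb.symm
    · exact fun h _ => absurd h.symm h3
    · exact fun h _ => absurd h h2
    · exact h1
  hand_ne hbm v hv := by
    rw [Function.update_apply]
    split_ifs with hvb
    · exact fun h => ha.hand_ne hh b (by omega) h.symm
    · exact fun h => hvb (ha.inj v hv b (by omega) h (h ▸ hbm))
  none_notMem := ha.none_notMem
  mem_iff c hc := by
    rw [ha.mem_iff c hc]
    constructor
    · rintro (rfl | ⟨v, hv, rfl⟩)
      · exact Or.inr ⟨b, by omega, Function.update_self ..⟩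
      · by_cases hvb : v = b
        · exact Or.inl (by rw [hvb])
        · exact Or.inr ⟨v, hv, Function.update_of_ne hvb ..⟩
    · rintro (rfl | ⟨v, hv, rfl⟩)
      · exact Or.inr ⟨b, by omega, rfl⟩
      · rw [Function.update_apply]
        split_ifs
        exacts [Or.inl rfl, Or.inr ⟨v, hv, rfl⟩]
  extra_free hbm := by
    have hbn : n ≠ b := fun h => hbm (h ▸ (ha.extra_free hh).1)
    rw [Function.update_of_ne hbn, Function.update_of_ne hbn]
    exact ha.extra_free hh
  extra_taken := by
    simp only [Function.update_apply]
    split_ifs with hnb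
    · intro _
      rw [← hnb, (ha.extra_free hh).2]
    · exact ha.extra_taken
  price_free v hv := by
    simp only [Function.update_apply]
    split_ifs with hvb
    · exact fun h => absurd h hh
    · exact ha.price_free v hv
  slack v hv hvm u hu := by
    have hpu : p u ≤ Function.update p b (p b + 1) u := by
      rw [Function.update_apply]
      split_ifs with hub
      · rw [hub]
        omega
      · exact le_rfl
    by_cases hvb : v = b
    · rw [hvb, Function.update_self] at hu
      rw [hvb, Function.update_self]
      have := hmin u hu
      omega
    · rw [Function.update_of_ne hvb] at hu hvm ⊢
      have := ha.slack v hv hvm u hu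
      omega
  price_le v hv := by
    rw [Function.update_apply]
    split_ifs
    · have := (ha.extra_free hh).2
      omega
    · exact ha.price_le v hv
  sum_price hbm := by
    have hbn : b ≠ n := fun h => hbm (h ▸ (ha.extra_free hh).1)
    have hb' : b ∈ Finset.range n := Finset.mem_range.mpr (hb.resolve_left hbn).1
    have h1 := ha.sum_price hh
    have h2 : ∑ v ∈ (Finset.range n).erase b, Function.update p b (p b + 1) v =
        ∑ v ∈ (Finset.range n).erase b, p v := Finset.sum_congr rfl fun v hv =>
      Function.update_of_ne (Finset.ne_of_mem_erase hv) ..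
    rw [← Finset.add_sum_erase _ _ hb'] at h1 ⊢
    rw [Function.update_self, h2]
    omega

theorem succ (ha : IsAuction N n m S k f p m) : IsAuction N n m S (k + 1) f p m :=
  { ha with sum_price := fun h => absurd rfl h }

/-- While some color is unplaced, the ordinary prices sum to the number of bids, but `n` prices of
at most `n + 2` cannot exceed `n * (n + 2)`. -/
theorem hand_eq_none (ha : IsAuction N n m S k f p h) (hk : n * (n + 2) < k) : h = m := by
  by_contra hh
  have h1 := Finset.sum_le_card_nsmul (Finset.range n) p (n + 2) fun v hv =>
    ha.price_le v (Finset.mem_range.mp hv).le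
  rw [ha.sum_price hh, Finset.card_range, smul_eq_mul] at h1
  omega

theorem isMatching (ha : IsAuction N n m S k f p m) (hn : f n = m) : IsMatching N n m S f where
  le v hv := ha.le v hv.le
  mem := ha.mem
  inj u hu v hv := ha.inj u hu.le v hv.le
  none_notMem := ha.none_notMem
  mem_iff c hc := by
    rw [ha.mem_iff c hc, or_iff_right hc]
    refine ⟨fun ⟨v, hv, h⟩ => ⟨v, ?_, h⟩, fun ⟨v, hv, h⟩ => ⟨v, hv.le, h⟩⟩
    exact lt_of_le_of_ne hv fun hvn => hc (by rw [← h, hvn, hn])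

theorem not_matchable (ha : IsAuction N n m S k f p h) (hN : ∀ c, N c ⊆ Finset.range n)
    (hn : f n ≠ m) : ¬ Matchable N S := by
  intro hS
  -- Pigeonhole: `n` prices cannot occupy all `n + 1` levels from 1 to `n + 1`.
  obtain ⟨l, hl, hlp⟩ : ∃ l ∈ Finset.Icc 1 (n + 1), l ∉ (Finset.range n).image p := by
    refine Finset.exists_mem_notMem_of_card_lt_card (Finset.card_image_le.trans_lt ?_)
    simp
  have hlp : ∀ v < n, p v ≠ l := fun v hv h =>
    hlp (Finset.mem_image.mpr ⟨v, Finset.mem_range.mpr hv, h⟩)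
  obtain ⟨hl1, hl2⟩ := Finset.mem_Icc.mp hl
  set Y := (Finset.range n).filter (l < p ·) with hY
  have hYn : ∀ v ∈ Y, v < n ∧ l < p v := fun v hv =>
    ⟨Finset.mem_range.mp (Finset.mem_filter.mp hv).1, (Finset.mem_filter.mp hv).2⟩
  have hYm : ∀ v ∈ Y, f v ≠ m := fun v hv hvm => by
    have := ha.price_free v (hYn v hv).1 hvm
    have := (hYn v hv).2
    omega
  -- By slack, a neighbor of such an owner has price at least `l`; the level `l` being empty, its
  -- price exceeds `l`. Together with the owner of the dummy, the owners of `Y` are thus `|Y| + 1`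
  -- colors whose neighbors all lie in `Y`.
  have key : ∀ v ≤ n, f v ≠ m → l < p v → N (f v) ⊆ Y := by
    intro v hv hvm hpv u hu
    have hun := Finset.mem_range.mp (hN _ hu)
    have h1 := ha.slack v hv hvm u hu
    have h2 := hlp u hun
    exact Finset.mem_filter.mpr ⟨Finset.mem_range.mpr hun, by omega⟩
  have hcard : (insert (f n) (Y.image f)).card = Y.card + 1 := by
    rw [Finset.card_insert_of_notMem, Finset.card_image_of_injOn]
    · intro u hu v hv huv
      exact ha.inj u (hYn u hu).1.le v (hYn v hv).1.le huv (hYm u hu)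
    · intro hmem
      obtain ⟨v, hv, hvn⟩ := Finset.mem_image.mp hmem
      have := ha.inj v (hYn v hv).1.le n le_rfl hvn (hYm v hv)
      have := (hYn v hv).1
      omega
  have hsub : insert (f n) (Y.image f) ⊆ S := by
    intro c hc
    rcases Finset.mem_insert.mp hc with rfl | hc
    · exact (ha.mem_iff _ hn).mpr (Or.inr ⟨n, le_rfl, rfl⟩)
    · obtain ⟨v, hv, rfl⟩ := Finset.mem_image.mp hc
      exact (ha.mem_iff _ (hYm v hv)).mpr (Or.inr ⟨v, (hYn v hv).1.le, rfl⟩)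
  have hN : (insert (f n) (Y.image f)).biUnion N ⊆ Y := by
    refine Finset.biUnion_subset.mpr fun c hc => ?_
    rcases Finset.mem_insert.mp hc with rfl | hc
    · exact key n le_rfl hn (by rw [ha.extra_taken hn]; omega)
    · obtain ⟨v, hv, rfl⟩ := Finset.mem_image.mp hc
      exact key v (hYn v hv).1.le (hYm v hv) (hYn v hv).2
  have := (hS.mono hsub).card_le
  have := Finset.card_le_card hN
  omega

end IsAuction

/-! ### The program -/

namespace RAM

/-- Run programs one after the other. -/
def Stmt.list : List Stmt → Stmt
  | [] => .skip
  | p :: l => .seq p (Stmt.list l)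

theorem Stmt.run_list_nil (e : Env) : (Stmt.list []).run e = e := rfl

theorem Stmt.run_list_cons (p : Stmt) (l : List Stmt) (e : Env) :
    (Stmt.list (p :: l)).run e = (Stmt.list l).run (p.run e) := rfl

theorem Stmt.run_skip (e : Env) : Stmt.skip.run e = e := rfl

theorem Stmt.run_op (o : Op) (e : Env) : (Stmt.op o).run e = o.run e := rfl

theorem Stmt.run_ifPos (x : ℕ) (p q : Stmt) (e : Env) :
    (Stmt.ifPos x p q).run e = if 0 < e.v x then p.run e else q.run e := rfl

/-- The invariant rule with the frame conditions built in, so that invariants need only mention what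
the loop changes. -/
theorem Stmt.run_loop_frame (I : ℕ → Env → Prop) {e : Env} {i b : ℕ} {p : Stmt} (h0 : I 0 e)
    (hs : ∀ k e', k < e.v b → (∀ x, x ∉ (Stmt.loop i b p).vars → e'.v x = e.v x) →
      (∀ x, x ∉ p.arrs → e'.a x = e.a x) → I k e' → I (k + 1) (p.run (e'.setv i k))) :
    I (e.v b) ((Stmt.loop i b p).run e) := by
  refine (Stmt.run_loop (fun k e' => I k e' ∧
    (∀ x, x ∉ (Stmt.loop i b p).vars → e'.v x = e.v x) ∧ (∀ x, x ∉ p.arrs → e'.a x = e.a x))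
    ⟨h0, fun _ _ => rfl, fun _ _ => rfl⟩ fun k e' hk ⟨hI, hv, ha⟩ =>
      ⟨hs k e' hk hv ha hI, ?_, ?_⟩).1
  · intro x hx
    simp only [Stmt.vars, List.mem_cons, not_or] at hx
    rw [Stmt.run_v hx.2, Env.setv_v, if_neg hx.1]
    exact hv x (by simpa only [Stmt.vars, List.mem_cons, not_or] using hx)
  · intro x hx
    rw [Stmt.run_a hx, Env.setv_a]
    exact ha x hx

end RAM

namespace WLCP

open RAM Stmt Op

/-- Skip the adjacency matrix. -/
def skipGraph : Stmt := loop 3 0 (loop 4 0 (op (read 5)))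

/-- Read the vertex-color incidence matrix into array `0`. -/
def readLists : Stmt :=
  Stmt.list [op (const 6 0), loop 3 0 (loop 4 1 (Stmt.list [op (read 5), op (set 0 6 5),
    op (inc 6 6)]))]

/-- Read the weights into array `1` and compute an upper bound in variable `7`. -/
def readWeights : Stmt :=
  Stmt.list [op (const 7 0), loop 3 1 (Stmt.list [op (read 5), op (set 1 3 5), op (sub 11 5 7),
    ifPos 11 (op (copy 7 5)) skip])]

/-- Replace weights by keys that are positive and decrease with the weight. -/
def makeKeys : Stmt :=
  Stmt.list [op (inc 7 7), loop 3 1 (Stmt.list [op (get 5 1 3), op (sub 5 7 5), op (set 1 3 5)]),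
    op (const 5 0), op (set 1 1 5)]

/-- Start with the empty matching in array `2`. -/
def clearMatching : Stmt := loop 3 0 (op (set 2 3 1))

/-- Find in variable `8` a color with the largest key. -/
def selectColor : Stmt :=
  Stmt.list [op (copy 8 1), loop 3 1 (Stmt.list [op (get 5 1 8), op (get 11 1 3),
    op (sub 11 11 5), ifPos 11 (op (copy 8 3)) skip])]

/-- Start an auction for the selected color with a copy of the matching in array `3` and
prices in array `4`. The key of the selected color becomes `0`. -/
def startAuction : Stmt :=
  Stmt.list [op (const 5 0), op (set 1 8 5),
    loop 3 0 (Stmt.list [op (get 11 2 3), op (set 3 3 11), op (set 4 3 5)]),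
    op (set 3 0 1), op (inc 5 0), op (set 4 0 5), op (copy 9 8)]

/-- Look up the list entry of the color in variable `9` in the row that starts at the position in
variable `6`, and move on to the next row. -/
def lookup : Stmt :=
  loop 4 1 (Stmt.list [op (sub 11 4 9), op (sub 12 9 4),
    ifPos 11 skip (ifPos 12 skip (op (get 5 0 6))), op (inc 6 6)])

/-- Find in variable `10` the cheapest vertex for the color in variable `9`. -/
def findVertex : Stmt :=
  Stmt.list [op (copy 10 0), op (const 6 0), loop 3 0 (Stmt.list [lookup,
    ifPos 5 (Stmt.list [op (get 11 4 3), op (get 12 4 10), op (sub 11 12 11),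
      ifPos 11 (op (copy 10 3)) skip]) skip])]

/-- Hand the vertex in variable `10` over to the color in variable `9`. -/
def place : Stmt :=
  Stmt.list [op (get 11 3 10), op (set 3 10 9), op (get 12 4 10), op (inc 12 12),
    op (set 4 10 12), op (copy 9 11)]

/-- One bid of the auction. -/
def bid : Stmt := Stmt.list [op (sub 11 1 9), ifPos 11 (Stmt.list [findVertex, place]) skip]

/-- The auction. -/
def auction : Stmt := loop 13 2 (loop 14 2 bid)

/-- Keep the result of the auction if all colors have got a vertex of the graph. -/
def commit : Stmt :=
  Stmt.list [op (get 11 3 0), op (sub 11 1 11),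
    ifPos 11 skip (loop 3 0 (Stmt.list [op (get 5 3 3), op (set 2 3 5)]))]

/-- Consider one more color. -/
def phase : Stmt := Stmt.list [selectColor, startAuction, auction, commit]

/-- Check in variable `15` whether some vertex is unmatched. -/
def checkMatching : Stmt :=
  Stmt.list [op (const 15 0), loop 3 0 (Stmt.list [op (get 5 2 3), op (sub 5 1 5),
    ifPos 5 skip (op (const 15 1))])]

/-- Print the matching. -/
def printMatching : Stmt :=
  Stmt.list [op (const 5 1), op (print 5),
    loop 3 0 (Stmt.list [op (get 5 2 3), op (print 5)])]

/-- Print the answer. -/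
def output : Stmt :=
  Stmt.list [checkMatching, ifPos 15 (Stmt.list [op (const 5 0), op (print 5)]) printMatching]

/-- Read the input. -/
def input : Stmt := Stmt.list [skipGraph, readLists, readWeights, makeKeys, clearMatching]

/-- The program for the list coloring problem. -/
def program : Stmt := Stmt.list [input, loop 16 1 phase, output]

theorem loopsOk_program : program.loopsOk = true := by decide

theorem protectsBounds_program : program.protectsBounds := by
  unfold Stmt.protectsBounds
  decide

/-! #### Input -/

theorem skipGraph_inp (e : Env) : (skipGraph.run e).inp = e.inp.drop (e.v 0 * e.v 0) := by
  refine run_loop_frame (fun k e' => e'.inp = e.inp.drop (k * e.v 0)) (by simp)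
    fun k e' _ hv _ hI => ?_
  have h0 : (e'.setv 3 k).v 0 = e.v 0 := hv 0 (by decide)
  have := run_loop_frame (e := e'.setv 3 k) (i := 4) (b := 0) (p := op (read 5))
    (fun j e'' => e''.inp = e.inp.drop (k * e.v 0 + j)) hI fun j e'' _ _ _ hJ => by
      simp only [Stmt.run, Op.run, Env.setv_inp, Env.next_inp, hJ, List.tail_drop, Nat.add_assoc]
  rw [h0, ← Nat.succ_mul] at this
  exact this

theorem headD_drop (l : List ℕ) (k : ℕ) : (l.drop k).headD 0 = l.getD k 0 := by
  rw [List.headD_eq_head?_getD, List.head?_drop, List.getD_eq_getElem?_getD]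

theorem readLists_spec (e : Env) :
    (readLists.run e).inp = e.inp.drop (e.v 0 * e.v 1) ∧
      ∀ i < e.v 0 * e.v 1, (readLists.run e).a 0 i = e.inp.getD i 0 := by
  set J : ℕ → Env → Prop := fun q e' => e'.v 6 = q ∧ e'.inp = e.inp.drop q ∧
    ∀ i < q, e'.a 0 i = e.inp.getD i 0 with hJ
  refine (run_loop_frame (e := e.setv 6 0) (i := 3) (b := 0) (fun k e' => J (k * e.v 1) e')
    ⟨by simp, by simp, by simp⟩ fun k e' _ hv _ hI => ?_ : J (e.v 0 * e.v 1) _).2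
  have h1 : (e'.setv 3 k).v 1 = e.v 1 := hv 1 (by decide)
  have := run_loop_frame (e := e'.setv 3 k) (i := 4) (b := 1)
    (p := Stmt.list [op (read 5), op (set 0 6 5), op (inc 6 6)])
    (fun j e'' => J (k * e.v 1 + j) e'') hI fun j e'' _ _ _ ⟨h6, hi, ha⟩ => by
      refine ⟨by simp [Stmt.list, Stmt.run, Op.run, h6, Nat.add_assoc],
        by simp [Stmt.list, Stmt.run, Op.run, hi, Nat.add_assoc], fun i hlt => ?_⟩
      simp only [Stmt.list, Stmt.run, Op.run, Env.setv_v, Env.setv_a, Env.seta_a, Env.seta_v,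
        Env.setv_inp, hi, headD_drop]
      simp [h6]
      split_ifs with h
      · rw [h]
      · exact ha i (by omega)
  rw [h1, ← Nat.succ_mul] at this
  exact this

theorem readWeights_spec (e : Env) (c : ℕ) (hc : c < e.v 1) :
    (readWeights.run e).a 1 c = e.inp.getD c 0 ∧ e.inp.getD c 0 ≤ (readWeights.run e).v 7 := by
  refine (run_loop_frame (e := e.setv 7 0) (i := 3) (b := 1) (fun k e' =>
    e'.inp = e.inp.drop k ∧ ∀ c < k, e'.a 1 c = e.inp.getD c 0 ∧ e.inp.getD c 0 ≤ e'.v 7)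
    ⟨by simp, by simp⟩ fun k e' _ _ _ ⟨hi, ha⟩ => ?_).2 c hc
  obtain ⟨x, hx⟩ : ∃ x, e.inp.getD k 0 = x := ⟨_, rfl⟩
  have hi' : e'.inp.headD 0 = x := by rw [hi, headD_drop, hx]
  have hstep : (e'.inp.tail = e.inp.drop (k + 1)) := by rw [hi, List.tail_drop]
  have hcase : ∀ c, c < k + 1 → c < k ∨ c = k := fun c hc => Nat.lt_succ_iff_lt_or_eq.mp hc
  by_cases h : e'.v 7 < x <;>
        simp only [run_list_nil, run_list_cons, run_skip, run_op, run_ifPos, Op.run] <;>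
    simp [hi', hstep, h, -List.headD_eq_head?_getD, -List.getD_eq_getElem?_getD] <;>
    refine fun c hc => (hcase c (by omega)).elim (fun hck => ?_) fun hck => ?_ <;>
    have h2 := ha c <;> subst_vars <;> grind

/-- The added 1 makes every genuine key positive, which leaves 0 to mark the nonexistent color `m`
and, later, the colors already considered. -/
theorem makeKeys_spec (e : Env) :
    (∀ c < e.v 1, (makeKeys.run e).a 1 c = e.v 7 + 1 - e.a 1 c) ∧
      (makeKeys.run e).a 1 (e.v 1) = 0 := by
  have key := run_loop_frame (e := e.setv 7 (e.v 7 + 1)) (i := 3) (b := 1)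
    (p := Stmt.list [op (get 5 1 3), op (sub 5 7 5), op (set 1 3 5)])
    (fun k e' => ∀ c, e'.a 1 c = if c < k then e.v 7 + 1 - e.a 1 c else e.a 1 c)
    (by simp) fun k e' _ hv _ hI c => by
      have h7 : e'.v 7 = e.v 7 + 1 := hv 7 (by decide)
      simp only [run_list_nil, run_list_cons, run_op, Op.run]
      simp [hI, h7]
      grind
  have hv := run_v (p := loop 3 1 (Stmt.list [op (get 5 1 3), op (sub 5 7 5), op (set 1 3 5)]))
    (x := 1) (by decide) (e.setv 7 (e.v 7 + 1))
  simp only [Env.setv_v, OfNat.one_ne_ofNat, if_false] at key hv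
  simp only [makeKeys, run_list_nil, run_list_cons, run_op, Op.run]
  simp [hv, key]
  grind

theorem clearMatching_spec (e : Env) (v : ℕ) (hv : v < e.v 0) :
    (clearMatching.run e).a 2 v = e.v 1 := by
  refine run_loop_frame (fun k e' => ∀ v < k, e'.a 2 v = e.v 1) (by simp)
    (fun k e' _ hv _ hI v hvk => ?_) v hv
  have h1 : e'.v 1 = e.v 1 := hv 1 (by decide)
  have := hI v
  simp [Stmt.run, Op.run, h1]
  omega

/-! #### One phase -/

theorem selectColor_spec (e : Env) :
    (selectColor.run e).v 8 ≤ e.v 1 ∧ (∀ c ≤ e.v 1, e.a 1 c ≤ e.a 1 ((selectColor.run e).v 8)) := by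
  obtain ⟨h1, h2, h3⟩ := run_loop_frame (e := e.setv 8 (e.v 1)) (i := 3) (b := 1)
    (p := Stmt.list [op (get 5 1 8), op (get 11 1 3), op (sub 11 11 5),
      ifPos 11 (op (copy 8 3)) skip])
    (fun k e' => e'.v 8 ≤ e.v 1 ∧ e.a 1 (e.v 1) ≤ e.a 1 (e'.v 8) ∧
      ∀ c < k, e.a 1 c ≤ e.a 1 (e'.v 8))
    (by simp) fun k e' hk _ ha ⟨h1, h2, h3⟩ => by
      have ha1 : e'.a 1 = e.a 1 := ha 1 (by decide)
      have hk : k < e.v 1 := hk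
      have hcase : ∀ c, c < k + 1 → c < k ∨ c = k := fun c hc => Nat.lt_succ_iff_lt_or_eq.mp hc
      by_cases h : e.a 1 (e'.v 8) < e.a 1 k <;>
        simp only [run_list_nil, run_list_cons, run_skip, run_op, run_ifPos, Op.run] <;>
        simp [ha1, h] <;> refine ⟨by omega, by omega, fun c hc => ?_⟩ <;> have h4 := h3 c <;>
        rcases hcase c (by omega) with hck | rfl <;> omega
  refine ⟨h1, fun c hc => ?_⟩
  rcases hc.lt_or_eq with hc | rfl
  exacts [h3 c hc, h2]

theorem startAuction_spec (e : Env) :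
    (∀ v < e.v 0, (startAuction.run e).a 3 v = e.a 2 v) ∧
    (startAuction.run e).a 3 (e.v 0) = e.v 1 ∧
    (∀ v < e.v 0, (startAuction.run e).a 4 v = 0) ∧
    (startAuction.run e).a 4 (e.v 0) = e.v 0 + 1 ∧
    (startAuction.run e).v 9 = e.v 8 ∧
    ∀ c, (startAuction.run e).a 1 c = if c = e.v 8 then 0 else e.a 1 c := by
  have key := run_loop_frame (e := (e.setv 5 0).seta 1 (e.v 8) 0) (i := 3) (b := 0)
    (p := Stmt.list [op (get 11 2 3), op (set 3 3 11), op (set 4 3 5)])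
    (fun k e' => ∀ v < k, e'.a 3 v = e.a 2 v ∧ e'.a 4 v = 0)
    (by simp) fun k e' _ hv ha hI v hvk => by
      have h5 : e'.v 5 = 0 := hv 5 (by decide)
      have h2 : e'.a 2 = e.a 2 := ha 2 (by decide)
      have := hI v
      simp only [run_list_nil, run_list_cons, run_op, Op.run]
      simp [h2, h5]
      grind
  have hv := fun x hx => run_v (x := x)
    (p := loop 3 0 (Stmt.list [op (get 11 2 3), op (set 3 3 11), op (set 4 3 5)]))
    hx ((e.setv 5 0).seta 1 (e.v 8) 0)
  have ha := run_a (x := 1)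
    (p := loop 3 0 (Stmt.list [op (get 11 2 3), op (set 3 3 11), op (set 4 3 5)]))
    (by decide) ((e.setv 5 0).seta 1 (e.v 8) 0)
  have hv0 := hv 0 (by decide)
  have hv1 := hv 1 (by decide)
  have hv5 := hv 5 (by decide)
  have hv8 := hv 8 (by decide)
  simp at hv0 hv1 hv5 hv8 key
  simp only [startAuction, run_list_nil, run_list_cons, run_op, Op.run]
  simp [hv0, hv1, hv8, ha]
  grind

/-- Without multiplication in the language, the row is traversed step by step to advance the
position. Two truncated differences that both vanish detect the requested column. -/
theorem lookup_spec (e : Env) (hh : e.v 9 < e.v 1) :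
    (lookup.run e).v 5 = e.a 0 (e.v 6 + e.v 9) ∧ (lookup.run e).v 6 = e.v 6 + e.v 1 := by
  obtain ⟨h1, h2⟩ := run_loop_frame (e := e) (i := 4) (b := 1)
    (p := Stmt.list [op (sub 11 4 9), op (sub 12 9 4),
      ifPos 11 skip (ifPos 12 skip (op (get 5 0 6))), op (inc 6 6)])
    (fun k e' => (e.v 9 < k → e'.v 5 = e.a 0 (e.v 6 + e.v 9)) ∧ e'.v 6 = e.v 6 + k)
    (by simp) fun k e' hk hv ha ⟨h1, h2⟩ => by
      have ha0 : e'.a 0 = e.a 0 := ha 0 (by decide)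
      have h9 : e'.v 9 = e.v 9 := hv 9 (by decide)
      by_cases h : e.v 9 < k
      · simp only [run_list_nil, run_list_cons, run_skip, run_op, run_ifPos, Op.run]
        simp [h9, h2, h, h1 h]
        omega
      · by_cases h' : k < e.v 9 <;>
        simp only [run_list_nil, run_list_cons, run_skip, run_op, run_ifPos, Op.run]
        · simp [h9, h2, h, h']
          omega
        · obtain rfl : k = e.v 9 := by omega
          simp [ha0, h9, h2]
          omega
  exact ⟨h1 hh, h2⟩

/-- The vertices below `n` whose lists contain the color `c`, where `L` is the incidence matrix. -/
def listNbr (L : ℕ → ℕ) (n m c : ℕ) : Finset ℕ :=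
  (Finset.range n).filter fun v => 0 < L (v * m + c)

/-- The search starts from the dummy vertex, so a candidate always exists and its price is at most
the dummy price. These are the hypotheses of `IsAuction.bid`. -/
theorem findVertex_spec (e : Env) (hh : e.v 9 < e.v 1) :
    ((findVertex.run e).v 10 = e.v 0 ∨ (findVertex.run e).v 10 < e.v 0 ∧
      (findVertex.run e).v 10 ∈ listNbr (e.a 0) (e.v 0) (e.v 1) (e.v 9)) ∧
    e.a 4 ((findVertex.run e).v 10) ≤ e.a 4 (e.v 0) ∧
    ∀ u ∈ listNbr (e.a 0) (e.v 0) (e.v 1) (e.v 9), e.a 4 ((findVertex.run e).v 10) ≤ e.a 4 u := by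
  obtain ⟨h1, h2, h3, h4⟩ := run_loop_frame (e := (e.setv 10 (e.v 0)).setv 6 0) (i := 3) (b := 0)
    (p := Stmt.list [lookup, ifPos 5 (Stmt.list [op (get 11 4 3), op (get 12 4 10),
      op (sub 11 12 11), ifPos 11 (op (copy 10 3)) skip]) skip])
    (fun k e' => e'.v 6 = k * e.v 1 ∧
      (e'.v 10 = e.v 0 ∨ e'.v 10 < e.v 0 ∧
        e'.v 10 ∈ listNbr (e.a 0) (e.v 0) (e.v 1) (e.v 9)) ∧
      e.a 4 (e'.v 10) ≤ e.a 4 (e.v 0) ∧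
      ∀ u ∈ listNbr (e.a 0) (e.v 0) (e.v 1) (e.v 9), u < k → e.a 4 (e'.v 10) ≤ e.a 4 u)
    (by simp) fun k e' hk hv ha ⟨h1, h2, h3, h4⟩ => by
      have hk : k < e.v 0 := hk
      have ha0 : e'.a 0 = e.a 0 := ha 0 (by decide)
      have ha4 : e'.a 4 = e.a 4 := ha 4 (by decide)
      have h9 : e'.v 9 = e.v 9 := hv 9 (by decide)
      have hm : e'.v 1 = e.v 1 := hv 1 (by decide)
      obtain ⟨l5, l6⟩ := lookup_spec (e'.setv 3 k) (by simpa [h9, hm] using hh)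
      have f3 := run_v (p := lookup) (x := 3) (by decide) (e'.setv 3 k)
      have f10 := run_v (p := lookup) (x := 10) (by decide) (e'.setv 3 k)
      have fa := run_a (p := lookup) (x := 4) (by decide) (e'.setv 3 k)
      simp [ha0, h9, h1, hm, ha4] at l5 l6 f3 f10 fa
      rw [← Nat.succ_mul] at l6
      have hmem : k ∈ listNbr (e.a 0) (e.v 0) (e.v 1) (e.v 9) ↔ 0 < e.a 0 (k * e.v 1 + e.v 9) := by
        simp [listNbr, hk]
      set N := listNbr (e.a 0) (e.v 0) (e.v 1) (e.v 9)
      have hsplit : ∀ u, u < k + 1 → u < k ∨ u = k := fun u hu => Nat.lt_succ_iff_lt_or_eq.mp hu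
      by_cases h : 0 < e.a 0 (k * e.v 1 + e.v 9)
      · by_cases h' : e.a 4 k < e.a 4 (e'.v 10) <;>
          simp only [run_list_nil, run_list_cons, run_skip, run_op, run_ifPos, Op.run] <;>
          simp [l5, l6, f3, f10, fa, h, h']
        · refine ⟨Or.inr ⟨hk, hmem.mpr h⟩, by omega, fun u hu huk => ?_⟩
          rcases hsplit u (by omega) with hlt | rfl
          · have := h4 u hu hlt
            omega
          · exact le_rfl
        · refine ⟨h2, h3, fun u hu huk => ?_⟩
          rcases hsplit u (by omega) with hlt | rfl
          · exact h4 u hu hlt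
          · omega
      · simp only [run_list_nil, run_list_cons, run_skip, run_op, run_ifPos, Op.run]
        simp [l5, l6, f10, h]
        refine ⟨h2, h3, fun u hu huk => ?_⟩
        rcases hsplit u (by omega) with hlt | rfl
        · exact h4 u hu hlt
        · exact absurd (hmem.mp hu) h
  exact ⟨h2, h3, fun u hu => h4 u hu (Finset.mem_range.mp (Finset.mem_filter.mp hu).1)⟩

theorem place_spec (e : Env) :
    (place.run e).a 3 = Function.update (e.a 3) (e.v 10) (e.v 9) ∧
    (place.run e).a 4 = Function.update (e.a 4) (e.v 10) (e.a 4 (e.v 10) + 1) ∧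
    (place.run e).v 9 = e.a 3 (e.v 10) := by
  simp only [place, run_list_nil, run_list_cons, run_op, Op.run]
  refine ⟨funext fun v => ?_, funext fun v => ?_, ?_⟩ <;> simp [Function.update_apply]

theorem bid_spec (e : Env) {S : Finset ℕ} {k : ℕ}
    (ha : IsAuction (listNbr (e.a 0) (e.v 0) (e.v 1)) (e.v 0) (e.v 1) S k (e.a 3) (e.a 4)
      (e.v 9)) :
    IsAuction (listNbr (e.a 0) (e.v 0) (e.v 1)) (e.v 0) (e.v 1) S (k + 1) ((bid.run e).a 3)
      ((bid.run e).a 4) ((bid.run e).v 9) := by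
  by_cases h9 : e.v 9 = e.v 1
  · simp only [bid, run_list_nil, run_list_cons, run_skip, run_op, run_ifPos, Op.run]
    rw [h9] at ha
    simpa [h9] using ha.succ
  · have hlt : e.v 9 < e.v 1 := lt_of_le_of_ne ha.hand_le h9
    have hrun : bid.run e = place.run (findVertex.run (e.setv 11 (e.v 1 - e.v 9))) := by
      simp only [bid, run_list_nil, run_list_cons, run_skip, run_op, run_ifPos, Op.run]
      simp [hlt]
    obtain ⟨e1, he1⟩ : ∃ e1, e1 = e.setv 11 (e.v 1 - e.v 9) := ⟨_, rfl⟩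
    have hv : ∀ x, x ≠ 11 → e1.v x = e.v x := fun x hx => by rw [he1, Env.setv_v, if_neg hx]
    have haa : e1.a = e.a := by rw [he1, Env.setv_a]
    rw [hrun, ← he1]
    obtain ⟨h1, h2, h3⟩ := place_spec (findVertex.run e1)
    have f9 : (findVertex.run e1).v 9 = e1.v 9 := run_v (by decide) _
    have fa3 : (findVertex.run e1).a 3 = e1.a 3 := run_a (by decide) _
    have fa4 : (findVertex.run e1).a 4 = e1.a 4 := run_a (by decide) _
    obtain ⟨g1, g2, g3⟩ := findVertex_spec e1
      (by rw [hv 9 (by decide), hv 1 (by decide)]; exact hlt)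
    rw [haa, hv 0 (by decide), hv 9 (by decide), hv 1 (by decide)] at *
    rw [h1, h2, h3, f9, fa3, fa4]
    exact ha.bid h9 g1 g2 g3

theorem auction_spec (e : Env) (h2 : e.v 2 = e.v 0 + 2) {S : Finset ℕ}
    (ha : IsAuction (listNbr (e.a 0) (e.v 0) (e.v 1)) (e.v 0) (e.v 1) S 0 (e.a 3) (e.a 4)
      (e.v 9)) :
    IsAuction (listNbr (e.a 0) (e.v 0) (e.v 1)) (e.v 0) (e.v 1) S ((e.v 0 + 2) * (e.v 0 + 2))
      ((auction.run e).a 3) ((auction.run e).a 4) (e.v 1) := by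
  set I : ℕ → Env → Prop := fun k e' => IsAuction (listNbr (e.a 0) (e.v 0) (e.v 1)) (e.v 0)
    (e.v 1) S k (e'.a 3) (e'.a 4) (e'.v 9) with hI
  have key : I ((e.v 0 + 2) * (e.v 0 + 2)) (auction.run e) := by
    have := run_loop_frame (e := e) (i := 13) (b := 2) (p := loop 14 2 bid)
      (fun k e' => I (k * (e.v 0 + 2)) e') (by simpa [hI] using ha) fun k e' _ hv haa hk => by
        have v0 : e'.v 0 = e.v 0 := hv 0 (by decide)
        have v1 : e'.v 1 = e.v 1 := hv 1 (by decide)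
        have v2 : (e'.setv 13 k).v 2 = e.v 0 + 2 := (hv 2 (by decide)).trans h2
        have a0 : e'.a 0 = e.a 0 := haa 0 (by decide)
        have := run_loop_frame (e := e'.setv 13 k) (i := 14) (b := 2) (p := bid)
          (fun j e'' => I (k * (e.v 0 + 2) + j) e'') hk fun j e'' _ hv' haa' hj => by
            have v0' : e''.v 0 = e.v 0 := (hv' 0 (by decide)).trans v0
            have v1' : e''.v 1 = e.v 1 := (hv' 1 (by decide)).trans v1
            have a0' : e''.a 0 = e.a 0 := (haa' 0 (by decide)).trans a0
            have := bid_spec (e''.setv 14 j) (S := S) (k := k * (e.v 0 + 2) + j)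
              (by simpa [hI, v0', v1', a0'] using hj)
            rw [← Nat.add_assoc]
            simpa [hI, v0', v1', a0'] using this
        rw [v2, ← Nat.succ_mul] at this
        exact this
    rw [h2] at this
    exact this
  -- The two nested loops make `(n + 2) * (n + 2)` rounds, which exceeds the limit `n * (n + 2)`;
  -- rounds without an unplaced color are idle.
  have h9 := key.hand_eq_none (by
    have : (e.v 0 + 2) * (e.v 0 + 2) = e.v 0 * (e.v 0 + 2) + 2 * (e.v 0 + 2) := by ring
    omega)
  simp only [hI, h9] at key
  exact key

theorem commit_spec (e : Env) (v : ℕ) (hv : v < e.v 0) (hle : e.a 3 (e.v 0) ≤ e.v 1) :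
    (commit.run e).a 2 v = if e.a 3 (e.v 0) = e.v 1 then e.a 3 v else e.a 2 v := by
  split_ifs with h
  · have := run_loop_frame (e := (e.setv 11 (e.v 1)).setv 11 0) (i := 3) (b := 0)
      (p := Stmt.list [op (get 5 3 3), op (set 2 3 5)]) (fun k e' => ∀ v < k, e'.a 2 v = e.a 3 v)
      (by simp) (fun k e' _ _ haa hI v hvk => by
        have a3 : e'.a 3 = e.a 3 := haa 3 (by decide)
        have := hI v
        simp only [run_list_nil, run_list_cons, run_op, Op.run]
        simp [a3]
        grind) v hv
    simp only [commit, run_list_nil, run_list_cons, run_skip, run_op, run_ifPos, Op.run]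
    simpa [h] using this
  · simp only [commit, run_list_nil, run_list_cons, run_skip, run_op, run_ifPos, Op.run]
    simp [lt_of_le_of_ne hle h]

/-- The state of the program after `k` phases: the colors in `P` have been considered, and the
colors in `A` have been matched. -/
structure PhaseInv (L w : ℕ → ℕ) (n m W k : ℕ) (P A : Finset ℕ) (e : Env) : Prop where
  card : P.card = k
  subset : P ⊆ Finset.range m
  greedy : IsGreedy (listNbr L n m) w P A
  order : ∀ c ∈ P, ∀ d < m, d ∉ P → w c ≤ w d
  matching : IsMatching (listNbr L n m) n m A (e.a 2)
  key_mem : ∀ c ∈ P, e.a 1 c = 0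
  key_notMem : ∀ c < m, c ∉ P → e.a 1 c = W + 1 - w c
  key_none : e.a 1 m = 0

/-- A largest key belongs to a lightest color not yet considered. The outcome of its auction decides
between `IsGreedy.accept` and `IsGreedy.reject`. -/
theorem phase_spec {L w : ℕ → ℕ} {n m W k : ℕ} (hW : ∀ c < m, w c ≤ W) (hk : k < m)
    {P A : Finset ℕ} {e : Env} (hI : PhaseInv L w n m W k P A e) (h0 : e.v 0 = n)
    (h1 : e.v 1 = m) (h2 : e.v 2 = n + 2) (hL : e.a 0 = L) :
    ∃ P' A', PhaseInv L w n m W (k + 1) P' A' (phase.run e) := by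
  obtain ⟨s1, s2⟩ := selectColor_spec e
  rw [h1] at s1 s2
  set e1 := selectColor.run e with he1
  set j := e1.v 8 with hj
  -- Some color is still unconsidered and has a positive key, so the selected key is positive too;
  -- this excludes `m` and the colors in `P`.
  obtain ⟨d, hdm, hdP⟩ : ∃ d ∈ Finset.range m, d ∉ P :=
    Finset.exists_mem_notMem_of_card_lt_card (by rw [hI.card, Finset.card_range]; exact hk)
  have hdm := Finset.mem_range.mp hdm
  have hd : 0 < e.a 1 j := by
    have := s2 d hdm.le
    rw [hI.key_notMem d hdm hdP] at this
    have := hW d hdm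
    omega
  have hjm : j < m := lt_of_le_of_ne s1 fun h => by rw [h, hI.key_none] at hd; omega
  have hjP : j ∉ P := fun h => by rw [hI.key_mem j h] at hd; omega
  have hmin : ∀ c < m, c ∉ P → w j ≤ w c := fun c hc hcP => by
    have := s2 c hc.le
    rw [hI.key_notMem c hc hcP, hI.key_notMem j hjm hjP] at this
    have := hW c hc
    have := hW j hjm
    omega
  have v01 : e1.v 0 = n := (run_v (by decide) _).trans h0
  have v11 : e1.v 1 = m := (run_v (by decide) _).trans h1
  have v21 : e1.v 2 = n + 2 := (run_v (by decide) _).trans h2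
  have a1 : ∀ i, e1.a i = e.a i := fun i => run_a (List.not_mem_nil) _
  obtain ⟨t1, t2, t3, t4, t5, t6⟩ := startAuction_spec e1
  set e2 := startAuction.run e1 with he2
  have v02 : e2.v 0 = n := (run_v (by decide) _).trans v01
  have v12 : e2.v 1 = m := (run_v (by decide) _).trans v11
  have v22 : e2.v 2 = n + 2 := (run_v (by decide) _).trans v21
  have a02 : e2.a 0 = L := ((run_a (by decide) _).trans (a1 0)).trans hL
  have a22 : e2.a 2 = e.a 2 := (run_a (by decide) _).trans (a1 2)
  rw [v01] at t1 t2 t3 t4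
  rw [v11] at t2
  simp only [a1] at t1 t6
  have hjA : j ∉ A := fun h => hjP (hI.greedy.subset h)
  have hauc := auction_spec e2 (S := insert j A) (by rw [v22, v02]) (by
    rw [v02, v12, a02, t5]
    exact IsAuction.start (hI.matching.congr t1) hjm hjA t2 t3 t4)
  set e3 := auction.run e2 with he3
  rw [v02, v12, a02] at hauc
  have v03 : e3.v 0 = n := (run_v (by decide) _).trans v02
  have v13 : e3.v 1 = m := (run_v (by decide) _).trans v12
  have a23 : e3.a 2 = e.a 2 := (run_a (by decide) _).trans a22
  have a13 : e3.a 1 = e2.a 1 := run_a (by decide) _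
  have hcom := commit_spec e3
  have hrun : phase.run e = commit.run e3 := rfl
  have a14 : (commit.run e3).a 1 = e2.a 1 := (run_a (by decide) _).trans a13
  rw [v03, v13, a23] at hcom
  have hcard : (insert j P).card = k + 1 := by rw [Finset.card_insert_of_notMem hjP, hI.card]
  have hsub : insert j P ⊆ Finset.range m :=
    Finset.insert_subset (Finset.mem_range.mpr hjm) hI.subset
  have hord : ∀ c ∈ insert j P, ∀ d < m, d ∉ insert j P → w c ≤ w d := by
    intro c hc d hd hdP
    rw [Finset.mem_insert, not_or] at hdP
    rcases Finset.mem_insert.mp hc with rfl | hc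
    exacts [hmin d hd hdP.2, hI.order c hc d hd hdP.2]
  have hkey1 : ∀ c ∈ insert j P, (commit.run e3).a 1 c = 0 := by
    intro c hc
    rw [a14, t6]
    split_ifs with h
    exacts [rfl, hI.key_mem c ((Finset.mem_insert.mp hc).resolve_left h)]
  have hkey2 : ∀ c < m, c ∉ insert j P → (commit.run e3).a 1 c = W + 1 - w c := by
    intro c hc hcP
    rw [Finset.mem_insert, not_or] at hcP
    rw [a14, t6, if_neg hcP.1]
    exact hI.key_notMem c hc hcP.2
  have hkey3 : (commit.run e3).a 1 m = 0 := by
    rw [a14, t6, if_neg hjm.ne', hI.key_none]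
  rw [hrun]
  by_cases hs : e3.a 3 n = m
  · have hm := hauc.isMatching hs
    refine ⟨insert j P, insert j A, hcard, hsub, hI.greedy.accept hm.matchable, hord,
      hm.congr fun v hv => ?_, hkey1, hkey2, hkey3⟩
    rw [hcom v hv (by omega), if_pos hs]
  · refine ⟨insert j P, A, hcard, hsub, hI.greedy.reject (fun c hc => hI.order c hc j hjm hjP)
      (hauc.not_matchable (fun c => Finset.filter_subset _ _) hs), hord,
      hI.matching.congr fun v hv => ?_, hkey1, hkey2, hkey3⟩
    rw [hcom v hv (hauc.le n le_rfl), if_neg hs]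

/-! #### Output -/

theorem checkMatching_spec (e : Env) (hle : ∀ v < e.v 0, e.a 2 v ≤ e.v 1) :
    0 < (checkMatching.run e).v 15 ↔ ∃ v < e.v 0, e.a 2 v = e.v 1 := by
  refine run_loop_frame (e := e.setv 15 0) (i := 3) (b := 0)
    (p := Stmt.list [op (get 5 2 3), op (sub 5 1 5), ifPos 5 skip (op (const 15 1))])
    (fun k e' => 0 < e'.v 15 ↔ ∃ v < k, e.a 2 v = e.v 1) (by simp) fun k e' hk hv haa hI => ?_
  have v1 : e'.v 1 = e.v 1 := hv 1 (by decide)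
  have a2 : e'.a 2 = e.a 2 := haa 2 (by decide)
  have hk := hle k hk
  rw [Nat.exists_lt_succ_right, ← hI]
  by_cases h : e.a 2 k < e.v 1 <;>
    simp only [run_list_nil, run_list_cons, run_skip, run_op, run_ifPos, Op.run] <;>
    simp [v1, a2, h] <;> omega

theorem printMatching_spec (e : Env) :
    (printMatching.run e).out = e.out ++ 1 :: (List.range (e.v 0)).map (e.a 2) := by
  have := run_loop_frame (e := { e.setv 5 1 with out := e.out ++ [1] }) (i := 3) (b := 0)
    (p := Stmt.list [op (get 5 2 3), op (print 5)])
    (fun k e' => e'.out = e.out ++ 1 :: (List.range k).map (e.a 2)) (by simp)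
    fun k e' hk hv haa hI => by
      have a2 : e'.a 2 = e.a 2 := haa 2 (by decide)
      simp only [run_list_nil, run_list_cons, run_op, Op.run]
      simp [a2, hI, List.range_succ]
  exact this

theorem output_spec (e : Env) (hle : ∀ v < e.v 0, e.a 2 v ≤ e.v 1) (hout : e.out = []) :
    ((∃ v < e.v 0, e.a 2 v = e.v 1) → (output.run e).out = [0]) ∧
    ((¬ ∃ v < e.v 0, e.a 2 v = e.v 1) →
      (output.run e).out = 1 :: (List.range (e.v 0)).map (e.a 2)) := by
  have h15 := checkMatching_spec e hle
  have ho : (checkMatching.run e).out = [] := (run_out (by decide) _).trans hout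
  have v0 : (checkMatching.run e).v 0 = e.v 0 := run_v (by decide) _
  have a2 : (checkMatching.run e).a 2 = e.a 2 := run_a (by decide) _
  constructor
  · intro h
    simp only [output, run_list_nil, run_list_cons, run_op, run_ifPos, Op.run, if_pos (h15.mpr h)]
    simp [ho]
  · intro h
    simp only [output, run_list_nil, run_list_cons, run_op, run_ifPos, Op.run, if_neg (mt h15.mp h)]
    rw [printMatching_spec, ho, v0, a2]
    rfl

/-- What the program prints on an input with `n` vertices and `m` colors. -/
theorem program_spec (n m : ℕ) (x : List ℕ) :
    ∃ (L : ℕ → ℕ) (A : Finset ℕ) (f : ℕ → ℕ), (∀ i < n * m, L i = x.getD (n * n + i) 0) ∧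
      IsGreedy (listNbr L n m) (fun c => x.getD (n * n + n * m + c) 0) (Finset.range m) A ∧
      IsMatching (listNbr L n m) n m A f ∧
      ((∃ v < n, f v = m) → (program.run (startEnv n m x)).out = [0]) ∧
      ((¬ ∃ v < n, f v = m) →
        (program.run (startEnv n m x)).out = 1 :: (List.range n).map f) := by
  set w : ℕ → ℕ := fun c => x.getD (n * n + n * m + c) 0 with hw
  set e0 := startEnv n m x with he0
  set e1 := skipGraph.run e0 with he1
  set e2 := readLists.run e1 with he2
  set e3 := readWeights.run e2 with he3
  set e4 := makeKeys.run e3 with he4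
  set e5 := clearMatching.run e4 with he5
  set e6 := (loop 16 1 phase).run e5 with he6
  have v1 : ∀ b < 3, e1.v b = e0.v b := fun b hb => run_v (by revert b; decide) _
  have v2 : ∀ b < 3, e2.v b = e0.v b := fun b hb =>
    (run_v (by revert b; decide) _).trans (v1 b hb)
  have v3 : ∀ b < 3, e3.v b = e0.v b := fun b hb =>
    (run_v (by revert b; decide) _).trans (v2 b hb)
  have v4 : ∀ b < 3, e4.v b = e0.v b := fun b hb =>
    (run_v (by revert b; decide) _).trans (v3 b hb)
  have v5 : ∀ b < 3, e5.v b = e0.v b := fun b hb =>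
    (run_v (by revert b; decide) _).trans (v4 b hb)
  have v6 : ∀ b < 3, e6.v b = e0.v b := fun b hb =>
    (run_v (by revert b; decide) _).trans (v5 b hb)
  have hn : e0.v 0 = n := rfl
  have hm : e0.v 1 = m := rfl
  have hn2 : e0.v 2 = n + 2 := rfl
  have i1 : e1.inp = x.drop (n * n) := skipGraph_inp e0
  obtain ⟨i2, l2⟩ := readLists_spec e1
  rw [v1 0 (by decide), v1 1 (by decide), hn, hm, i1] at i2 l2
  rw [List.drop_drop] at i2
  have hw3 := readWeights_spec e2
  obtain ⟨k1, k2⟩ := makeKeys_spec e3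
  have c2 := clearMatching_spec e4
  have a15 : e5.a 1 = e4.a 1 := run_a (by decide) _
  have a05 : e5.a 0 = e2.a 0 := ((run_a (by decide) _).trans (run_a (by decide) _)).trans
    (run_a (by decide) _)
  have a06 : e6.a 0 = e2.a 0 := (run_a (by decide) _).trans a05
  have hout : e6.out = [] := run_out (p := Stmt.list [skipGraph, readLists, readWeights, makeKeys,
    clearMatching, loop 16 1 phase]) (by decide) e0
  rw [v2 1 (by decide), hm, i2] at hw3
  rw [v3 1 (by decide), hm] at k1 k2
  rw [v4 0 (by decide), v4 1 (by decide), hn, hm] at c2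
  have hgetD : ∀ l : List ℕ, ∀ i j, (l.drop i).getD j 0 = l.getD (i + j) 0 := fun l i j => by
    rw [List.getD_eq_getElem?_getD, List.getElem?_drop, List.getD_eq_getElem?_getD]
  have start : PhaseInv (e2.a 0) w n m (e3.v 7) 0 ∅ ∅ e5 := by
    refine ⟨rfl, Finset.empty_subset _, IsGreedy.empty _ _, by simp, ⟨fun v hv => (c2 v hv).le,
      fun v hv h => absurd (c2 v hv) h, fun u hu v hv _ h => absurd (c2 u hu) h, by simp,
      fun c hc => ?_⟩, by simp, fun c hc _ => ?_, ?_⟩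
    · simp only [Finset.notMem_empty, false_iff, not_exists, not_and]
      intro v hv h
      exact hc (h.symm.trans (c2 v hv))
    · rw [a15, k1 c hc, (hw3 c hc).1, hgetD]
    · rw [a15, k2]
  have hphases := run_loop_frame (e := e5) (i := 16) (b := 1) (p := phase)
    (fun k e => ∃ P A, PhaseInv (e2.a 0) w n m (e3.v 7) k P A e) ⟨∅, ∅, start⟩
    fun k e hk hv ha ⟨P, A, hI⟩ => by
      rw [v5 1 (by decide), hm] at hk
      -- The state differs only by the assignment of the loop variable. All clauses of the invariant
      -- speak of arrays, so they carry over definitionally.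
      refine phase_spec (fun c hc => ?_) hk (P := P) (A := A) ⟨hI.card, hI.subset, hI.greedy,
        hI.order, hI.matching, hI.key_mem, hI.key_notMem, hI.key_none⟩ ?_ ?_ ?_ ?_
      · have := (hw3 c hc).2
        rw [hgetD] at this
        exact this
      · exact (hv 0 (by decide)).trans (v5 0 (by decide))
      · exact (hv 1 (by decide)).trans (v5 1 (by decide))
      · exact (hv 2 (by decide)).trans (v5 2 (by decide))
      · exact (ha 0 (by decide)).trans a05
  rw [← he6, v5 1 (by decide), hm] at hphases
  obtain ⟨P, A, hI⟩ := hphases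
  have hP : P = Finset.range m := Finset.eq_of_subset_of_card_le hI.subset
    (by rw [hI.card, Finset.card_range])
  have hgreedy := hI.greedy
  rw [hP] at hgreedy
  have ho := output_spec e6 (by
    rw [v6 0 (by decide), v6 1 (by decide)]
    exact hI.matching.le) hout
  rw [v6 0 (by decide), v6 1 (by decide), hn, hm] at ho
  refine ⟨e2.a 0, A, e6.a 2, fun i hi => ?_, hgreedy, hI.matching, ho.1, ho.2⟩
  rw [l2 i hi, hgetD]

end WLCP

/-! ### Instances in which all color graphs are complete -/

theorem List.flatMap_finRange_eq_ofFn {α : Type*} (n m : ℕ) (g : Fin n → Fin m → α) :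
    (List.finRange n).flatMap (fun u => (List.finRange m).map (g u)) =
      List.ofFn fun k : Fin (n * m) => g k.divNat k.modNat := by
  rw [List.ofFn_mul, List.flatMap_def, ← List.ofFn_eq_map]
  congr 1
  refine congrArg List.ofFn (funext fun u => ?_)
  rw [← List.ofFn_eq_map]
  refine congrArg List.ofFn (funext fun v => ?_)
  have hv : 0 < m := v.pos
  congr 1
  · ext
    simp [Fin.divNat, Nat.add_div_of_dvd_right, hv, mul_comm (u : ℕ)]
  · ext
    simp [Fin.modNat, Nat.mod_eq_of_lt v.2, mul_comm (u : ℕ)]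

theorem List.getD_ofFn {n : ℕ} (g : Fin n → ℕ) (i : Fin n) : (List.ofFn g).getD i 0 = g i := by
  simp

namespace WLCP

open RAM

open Classical in
/-- The part of the input after the numbers of vertices and colors. -/
noncomputable def encodeTail (I : WLCP) : List ℕ :=
  (List.ofFn fun k : Fin (I.n * I.n) => if I.G.Adj k.divNat k.modNat then 1 else 0)
    ++ (List.ofFn fun k : Fin (I.n * I.m) => if k.modNat ∈ I.L k.divNat then 1 else 0)
    ++ List.ofFn I.w

theorem encode_eq (I : WLCP) : I.encode = I.n :: I.m :: I.encodeTail := by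
  classical
  rw [encode, List.flatMap_finRange_eq_ofFn, List.flatMap_finRange_eq_ofFn, ← List.ofFn_eq_map,
    encodeTail]
  simp

theorem length_encodeTail (I : WLCP) :
    I.encodeTail.length = I.n * I.n + I.n * I.m + I.m := by
  simp [encodeTail, Nat.add_assoc]

theorem encodeTail_getD_list (I : WLCP) (v : Fin I.n) (c : Fin I.m) :
    0 < I.encodeTail.getD (I.n * I.n + (v * I.m + c)) 0 ↔ c ∈ I.L v := by
  classical
  have hlt : (v * I.m + c : ℕ) < I.n * I.m := by
    have := Nat.mul_le_mul_right I.m (Nat.succ_le_of_lt v.2)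
    rw [Nat.succ_mul] at this
    omega
  have hd : (⟨v * I.m + c, hlt⟩ : Fin (I.n * I.m)).divNat = v := by
    ext
    simp [Fin.divNat, Nat.mul_add_div, c.pos, mul_comm (v : ℕ)]
  have hm : (⟨v * I.m + c, hlt⟩ : Fin (I.n * I.m)).modNat = c := by
    ext
    simp [Fin.modNat, Nat.mod_eq_of_lt c.2, mul_comm (v : ℕ)]
  have key := List.getD_ofFn (fun k : Fin (I.n * I.m) => if k.modNat ∈ I.L k.divNat then 1 else 0)
    ⟨v * I.m + c, hlt⟩
  rw [encodeTail, List.append_assoc, List.getD_append_right _ _ _ _ (by simp), List.length_ofFn,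
    Nat.add_sub_cancel_left, List.getD_append _ _ _ _ (by simpa using hlt)]
  simp only [hd, hm] at key
  rw [key]
  split_ifs with h <;> simp [h]

theorem encodeTail_getD_weight (I : WLCP) (c : Fin I.m) :
    I.encodeTail.getD (I.n * I.n + I.n * I.m + c) 0 = I.w c := by
  rw [encodeTail, List.getD_append_right _ _ _ _ (by simp)]
  simp

/-- A list coloring is injective if all color graphs are complete. -/
theorem IsListColoring.injective {I : WLCP} (hI : ∀ j : Fin I.m, I.colorGraph j = ⊤)
    {f : Fin I.n → Fin I.m} (hf : I.IsListColoring f) : Function.Injective f := by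
  intro u v huv
  by_contra hne
  -- Both vertices have the color `f u` in their lists, hence are adjacent in its complete color
  -- graph.
  have hadj : (I.colorGraph (f u)).Adj ⟨u, hf.2 u⟩ ⟨v, huv ▸ hf.2 v⟩ := by
    rw [hI]
    exact fun h => hne (congrArg Subtype.val h)
  exact hf.1 u v hadj huv

/-- The active colors as natural numbers. -/
def colorNumbers (I : WLCP) (f : Fin I.n → Fin I.m) : Finset ℕ :=
  (I.activeColors f).map Fin.valEmbedding

theorem mem_colorNumbers {I : WLCP} {f : Fin I.n → Fin I.m} {c : ℕ} :
    c ∈ I.colorNumbers f ↔ ∃ v, (f v : ℕ) = c := by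
  simp [colorNumbers, activeColors]

theorem colorNumbers_subset (I : WLCP) (f : Fin I.n → Fin I.m) :
    I.colorNumbers f ⊆ Finset.range I.m := by
  intro c hc
  obtain ⟨v, rfl⟩ := mem_colorNumbers.mp hc
  exact Finset.mem_range.mpr (f v).2

theorem card_colorNumbers {I : WLCP} {f : Fin I.n → Fin I.m} (hf : Function.Injective f) :
    (I.colorNumbers f).card = I.n := by
  rw [colorNumbers, Finset.card_map, activeColors, Finset.card_image_of_injective _ hf,
    Finset.card_fin]

theorem weight_eq (I : WLCP) (f : Fin I.n → Fin I.m) :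
    I.weight f = ∑ c ∈ I.colorNumbers f,
      I.encodeTail.getD (I.n * I.n + I.n * I.m + c) 0 := by
  rw [colorNumbers, Finset.sum_map, weight]
  exact Finset.sum_congr rfl fun c _ => (I.encodeTail_getD_weight c).symm

/-- Each active color chooses a vertex that carries it; different colors choose different vertices
because `f` is a function. -/
theorem matchable_colorNumbers {I : WLCP} {N : ℕ → Finset ℕ}
    (hN : ∀ (v : Fin I.n) (c : Fin I.m), (v : ℕ) ∈ N c ↔ c ∈ I.L v) {f : Fin I.n → Fin I.m}
    (hf : I.IsListColoring f) : Matchable N (I.colorNumbers f) := by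
  have h : ∀ c ∈ I.colorNumbers f, ∃ v : ℕ, ∃ hv : v < I.n, (f ⟨v, hv⟩ : ℕ) = c := by
    intro c hc
    obtain ⟨v, rfl⟩ := mem_colorNumbers.mp hc
    exact ⟨v, v.2, rfl⟩
  choose! g hg hgc using h
  refine ⟨g, fun c hc d hd hcd => ?_, fun c hc => ?_⟩
  · rw [← hgc c hc, ← hgc d hd]
    simp only [hcd]
  · have := (hN ⟨g c, hg c hc⟩ (f ⟨g c, hg c hc⟩)).mpr (hf.2 _)
    rwa [hgc c hc] at this

theorem isAnswer_program {I : WLCP} (hI : ∀ j : Fin I.m, I.colorGraph j = ⊤) :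
    I.IsAnswer (program.run (startEnv I.n I.m I.encodeTail)).out := by
  obtain ⟨L, A, f, hL, hA, hf, hfail, hsucc⟩ := program_spec I.n I.m I.encodeTail
  have hN : ∀ (v : Fin I.n) (c : Fin I.m), (v : ℕ) ∈ listNbr L I.n I.m c ↔ c ∈ I.L v := by
    intro v c
    have hlt : (v * I.m + c : ℕ) < I.n * I.m := by
      have := Nat.mul_le_mul_right I.m (Nat.succ_le_of_lt v.2)
      rw [Nat.succ_mul] at this
      omega
    rw [listNbr, Finset.mem_filter, hL _ hlt, encodeTail_getD_list, Finset.mem_range]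
    exact and_iff_right v.2
  by_cases hv : ∃ v < I.n, f v = I.m
  · refine Or.inl ⟨fun ⟨g, hg⟩ => ?_, hfail hv⟩
    obtain ⟨v, hvn, hvm⟩ := hv
    have h1 := hA.card_le (matchable_colorNumbers hN hg) (I.colorNumbers_subset g)
    rw [card_colorNumbers (hg.injective hI)] at h1
    -- With `v` unmatched, `A` has at most `n - 1` elements, whereas a coloring would yield a
    -- matchable set of `n` colors.
    have h2 : A ⊆ ((Finset.range I.n).erase v).image f := by
      intro c hc
      have hcm : c ≠ I.m := fun h => hf.none_notMem (h ▸ hc)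
      obtain ⟨u, hu, rfl⟩ := (hf.mem_iff c hcm).mp hc
      exact Finset.mem_image.mpr ⟨u, Finset.mem_erase.mpr
        ⟨fun h => hcm (h ▸ hvm), Finset.mem_range.mpr hu⟩, rfl⟩
    have h3 := (Finset.card_le_card h2).trans Finset.card_image_le
    rw [Finset.card_erase_of_mem (Finset.mem_range.mpr hvn), Finset.card_range] at h3
    omega
  · have hne : ∀ v < I.n, f v ≠ I.m := fun v hvn hvm => hv ⟨v, hvn, hvm⟩
    have hlt : ∀ v : Fin I.n, f v < I.m := fun v => lt_of_le_of_ne (hf.le v v.2) (hne v v.2)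
    set F : Fin I.n → Fin I.m := fun v => ⟨f v, hlt v⟩ with hF
    have hinj : Function.Injective F := fun u v huv =>
      Fin.ext (hf.inj u u.2 v v.2 (congrArg Fin.val huv) (hne u u.2))
    have hFA : I.colorNumbers F = A := by
      ext c
      rw [mem_colorNumbers]
      constructor
      · rintro ⟨v, rfl⟩
        exact (hf.mem_iff _ (hne v v.2)).mpr ⟨v, v.2, rfl⟩
      · intro hc
        obtain ⟨v, hv, rfl⟩ := (hf.mem_iff c fun h => hf.none_notMem (h ▸ hc)).mp hc
        exact ⟨⟨v, hv⟩, rfl⟩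
    -- Injectivity alone makes `F` proper; completeness of the color graphs is needed only for its
    -- competitors `g`.
    have hcol : I.IsListColoring F :=
      ⟨fun u v huv h => huv.ne (hinj h), fun v => (hN v (F v)).mp (hf.mem v v.2 (hne v v.2))⟩
    refine Or.inr ⟨F, ⟨hcol, fun g hg => ?_⟩, ?_⟩
    · rw [weight_eq, weight_eq, hFA]
      refine hA.sum_le (matchable_colorNumbers hN hg) (I.colorNumbers_subset g) ?_
      rw [← hFA, card_colorNumbers hinj, card_colorNumbers (hg.injective hI)]
    · rw [hsucc hv]
      congr 1
      exact List.ext_getElem (by simp) fun i _ _ => by simp [hF]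

end WLCP

theorem mainTheorem1 :
    RAM.PolyTimeSolvableOn WLCP.encode WLCP.IsAnswer
      {I : WLCP | ∀ j : Fin I.m, I.colorGraph j = ⊤} := by
  obtain ⟨b, hb⟩ := RAM.exists_polynomial_exec WLCP.program WLCP.loopsOk_program
    WLCP.protectsBounds_program
  refine ⟨.seq (RAM.opsCode RAM.boundsOps) (WLCP.program.code 0), b, fun I hI => ?_⟩
  have hlen := I.length_encodeTail
  have hnn := Nat.le_mul_self I.n
  -- The matrices and the weights occupy `n * n + n * m + m` entries, so the loop bounds `n` and `m`
  -- are at most the input length.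
  obtain ⟨t, s, hex, ht, hs⟩ := hb I.n I.m I.encodeTail
    (by simp only [List.length_cons]; omega) (by simp only [List.length_cons]; omega)
  rw [WLCP.encode_eq]
  exact ⟨t, s, hex, ht, hs ▸ WLCP.isAnswer_program hI⟩
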